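/- Let $N\ge 2$ be an integer, let $B_1$ be the open unit ball of $\mathbb{R}^N$, and let $a\in C[0,1]$ satisfy $a(r)>0$ for all $r\in[0,1]$. Consider the singular Sturm–Liouville Neumann problem $$-u''(r)-\frac{N-1}{r}u'(r)=\mu\, a(r)\,u(r)\quad (0<r<1),\qquad u'(0)=0=u'(1),\tag{1}$$ with $\mu\in\mathbb{R}$ and real-valued $u\in C^2[0,1]$, and the Neumann problem $$-\Delta U(x)=\mu\, a(|x|)\,U(x)\quad (x\in B_1),\qquad \partial_\nu U=0\ \text{ on }\partial B_1,\tag{2}$$ with $\mu\in\mathbb{R}$ and real-valued radial $U\in C^2(\overline{B_1})$, that is, $U(x)=u(|x|)$ for some function $u$ on $[0,1]$. An eigenvalue of (1) (a radial eigenvalue of (2)) is a number $\mu$ for which there is a solution that is not identically zero, called an eigenfunction (a radial eigenfunction); it is called simple if the space of these solutions is one-dimensional. There is a sequence $0=\mu_0<\mu_1<\mu_2<\cdots$ with $\mu_k\to\infty$ such that the following hold. (a) The set of eigenvalues of (1) is exactly $\{\mu_k : k=0,1,2,\dots\}$. For each $k\ge 0$, $\mu_k$ is simple, and every eigenfunction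 $\psi_k$ of (1) for $\mu_k$ has exactly $k$ zeros in $[0,1]$, all of them simple (that is, $\psi_k'\neq 0$ there); moreover $\psi_k$ is monotone (nondecreasing or nonincreasing) on $[0,1]$ if and only if $k\in\{0,1\}$. (b) The set of radial eigenvalues of (2) is exactly $\{\mu_k : k=0,1,2,\dots\}$, with the same numbers $\mu_k$. For each $k\ge 0$, $\mu_k$ is simple as a radial eigenvalue, and every radial eigenfunction of (2) for $\mu_k$, regarded as a function of $r=|x|\in[0,1]$, has exactly $k$ zeros in $[0,1]$, all of them simple; moreover it is monotone in $r$ (nondecreasing or nonincreasing) if and only if $k\in\{0,1\}$. -/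

import Mathlib

open Set Filter Topology
open scoped Laplacian

/-- `u` is a solution of class `C²[0,1]` of the singular Sturm–Liouville Neumann problem
`-u'' - ((N-1)/r) u' = m a(r) u` on `(0,1)`, `u'(0) = 0 = u'(1)`.
Only the values of `u` on `[0,1]` matter. -/
structure IsNeumannSolution (N : ℕ) (a : ℝ → ℝ) (m : ℝ) (u : ℝ → ℝ) : Prop where
  contDiffOn : ContDiffOn ℝ 2 u (Icc 0 1)
  equation : ∀ r ∈ Ioo (0 : ℝ) 1,
    -(deriv (deriv u) r) - ((N : ℝ) - 1) / r * deriv u r = m * a r * u r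
  neumann_zero : derivWithin u (Icc 0 1) 0 = 0
  neumann_one : derivWithin u (Icc 0 1) 1 = 0

/-- An eigenfunction: a solution which does not vanish identically on `[0,1]`. -/
def IsNeumannEigenfunction (N : ℕ) (a : ℝ → ℝ) (m : ℝ) (u : ℝ → ℝ) : Prop :=
  IsNeumannSolution N a m u ∧ ∃ r ∈ Icc (0 : ℝ) 1, u r ≠ 0

/-- `m` is an eigenvalue of the Sturm–Liouville Neumann problem. -/
def IsNeumannEigenvalue (N : ℕ) (a : ℝ → ℝ) (m : ℝ) : Prop :=
  ∃ u : ℝ → ℝ, IsNeumannEigenfunction N a m u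

/-- The function `f` of the radius represents `U` on the closed unit ball: `U(x) = f(|x|)`. For
`N ≥ 1` the values of `f` on `[0,1]` are determined by `U`. -/
def IsRadialProfile (N : ℕ) (U : EuclideanSpace ℝ (Fin N) → ℝ) (f : ℝ → ℝ) : Prop :=
  ∀ x ∈ Metric.closedBall (0 : EuclideanSpace ℝ (Fin N)) 1, U x = f ‖x‖

/-- `U` is a radial eigenfunction, of class `C²` on the closed unit ball, of
`-ΔU = m a(|x|) U` in the open unit ball, `∂U/∂ν = 0` on the unit sphere. The outer unit normal at
a point `x` of the unit sphere is `x` itself. -/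
structure IsRadialNeumannEigenfunction (N : ℕ) (a : ℝ → ℝ) (m : ℝ)
    (U : EuclideanSpace ℝ (Fin N) → ℝ) : Prop where
  contDiffOn : ContDiffOn ℝ 2 U (Metric.closedBall 0 1)
  radial : ∃ f : ℝ → ℝ, IsRadialProfile N U f
  equation : ∀ x ∈ Metric.ball (0 : EuclideanSpace ℝ (Fin N)) 1,
    -(Δ U x) = m * a ‖x‖ * U x
  neumann : ∀ x ∈ Metric.sphere (0 : EuclideanSpace ℝ (Fin N)) 1,
    fderivWithin ℝ U (Metric.closedBall 0 1) x x = 0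
  ne_zero : ∃ x ∈ Metric.closedBall (0 : EuclideanSpace ℝ (Fin N)) 1, U x ≠ 0

/-- `m` is a radial eigenvalue of the Neumann problem in the unit ball. -/
def IsRadialNeumannEigenvalue (N : ℕ) (a : ℝ → ℝ) (m : ℝ) : Prop :=
  ∃ U : EuclideanSpace ℝ (Fin N) → ℝ, IsRadialNeumannEigenfunction N a m U

/-- `u` has exactly `k` zeros in `[0,1]`, and all of them are simple (`u' ≠ 0` there, the
derivative being one-sided at the end points). -/
def HasExactlySimpleZeros (u : ℝ → ℝ) (k : ℕ) : Prop :=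
  {r ∈ Icc (0 : ℝ) 1 | u r = 0}.encard = k ∧
    ∀ r ∈ Icc (0 : ℝ) 1, u r = 0 → derivWithin u (Icc 0 1) r ≠ 0

/-- `u` is monotone (nondecreasing or nonincreasing) on `[0,1]`. -/
def IsMonotoneOnUnitInterval (u : ℝ → ℝ) : Prop :=
  MonotoneOn u (Icc 0 1) ∨ AntitoneOn u (Icc 0 1)

/-! Put `n = N - 1`. The equation reads `(rⁿ u')' = -m rⁿ b u`, where `b` is a continuous extension
of `a`. Two integrations from the singular end point, with `u'(0) = 0`, turn it into `u = u(0) - m T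
u`, where `T` is a Volterra operator on `C[0,1]` with `‖T ^ k‖ ≤ A ^ k / k!`. Hence `1 + m T` is
invertible for every `m`: the solutions regular at `0` are the multiples of `radialSolution`, which
depends continuously on `m` (`eq_mul_radialSolution`, `continuous_uncurry_radialSolution`). This
gives simplicity, and reduces the eigenvalue condition `u'(1) = 0` to the scalar equation `m *
sourceMean n hb m 1 = 0`.

Negative `m` are excluded by an energy argument (`sourceMean_one_ne_zero_of_neg`). For `m = l ^ 2`
with `l > 0`, the vector `(u, -u'/l)` never vanishes (`pruferE_pos`). Its angle `θ` starts at `0`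
and satisfies `θ' = l (sin² θ + b cos² θ) - (n/r) sin θ cos θ` (`angularSpeed_eq`). The singular
term vanishes at multiples of `π/2`, so `θ` crosses these levels only upwards (`lt_pruferAngle`). It
cancels where the angles for two parameters meet, so `θ(1)` is strictly increasing in `l`
(`pruferAngle_lt_pruferAngle`); it is also unbounded (`exists_le_pruferAngle_one`). Thus exactly one
`l_k` gives `θ(1) = kπ`, and `μ_k = l_k ^ 2`. The zeros of `u` are the crossings of odd multiples of
`π/2`, exactly `k` in number (`encard_zeros_pruferU`). Two zeros are incompatible with monotonicity,
whereas for `k = 1` the angle stays in `(0, π)` on the open interval and `u'` keeps its sign.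

The ball problem has the same solutions: the profile of a `C²` radial eigenfunction solves the
interval problem (`isNeumannEigenfunction_of_isRadialProfile`), and `ballSolution` is `C²` through
the centre (`contDiff_ballSolution`). -/

namespace RadialNeumann

/-! ### Weighted means, which absorb the singularity at the origin -/

/-- The weighted mean `∫₀¹ tⁿ f(rt) dt`, equal to `r⁻ⁿ⁻¹ ∫₀ʳ sⁿ f(s) ds` for `r ≠ 0`. -/
noncomputable def radialMean (n : ℕ) (f : ℝ → ℝ) (r : ℝ) : ℝ :=
  ∫ t in (0 : ℝ)..1, t ^ n * f (r * t)

theorem continuous_radialMean_param {X : Type*} [TopologicalSpace X] (n : ℕ) {f : X → ℝ → ℝ}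
    (hf : Continuous (Function.uncurry f)) :
    Continuous (fun p : X × ℝ => radialMean n (f p.1) p.2) := by
  unfold radialMean
  refine intervalIntegral.continuous_parametric_intervalIntegral_of_continuous'
    (f := fun (p : X × ℝ) t => t ^ n * f p.1 (p.2 * t)) ?_ 0 1
  have h : Continuous fun q : (X × ℝ) × ℝ => Function.uncurry f (q.1.1, q.1.2 * q.2) :=
    hf.comp (by fun_prop)
  exact (continuous_snd.pow n).mul h

theorem continuous_radialMean (n : ℕ) {f : ℝ → ℝ} (hf : Continuous f) :
    Continuous (radialMean n f) := by
  have h := continuous_radialMean_param (X := Unit) n (f := fun _ => f)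
    (hf.comp continuous_snd)
  exact h.comp (by fun_prop : Continuous fun r : ℝ => ((), r))

theorem pow_mul_radialMean (n : ℕ) (f : ℝ → ℝ) (r : ℝ) :
    r ^ (n + 1) * radialMean n f r = ∫ s in (0 : ℝ)..r, s ^ n * f s := by
  have h := intervalIntegral.mul_integral_comp_mul_left (a := 0) (b := 1)
    (f := fun s => s ^ n * f s) r
  simp only [mul_zero, mul_one] at h
  rw [← h, radialMean, pow_succ', mul_assoc, ← intervalIntegral.integral_const_mul]
  congr 1
  refine intervalIntegral.integral_congr fun t _ => ?_
  simp only [mul_pow]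
  ring

theorem radialMean_zero (n : ℕ) (f : ℝ → ℝ) : radialMean n f 0 = f 0 / (n + 1) := by
  simp [radialMean, intervalIntegral.integral_mul_const, integral_pow]
  ring

theorem radialMean_const_mul (n : ℕ) (f : ℝ → ℝ) (c r : ℝ) :
    radialMean n (fun s => c * f s) r = c * radialMean n f r := by
  simp only [radialMean, ← intervalIntegral.integral_const_mul]
  exact intervalIntegral.integral_congr fun t _ => by ring

theorem radialMean_add (n : ℕ) {f g : ℝ → ℝ} (hf : Continuous f) (hg : Continuous g) (r : ℝ) :
    radialMean n (fun s => f s + g s) r = radialMean n f r + radialMean n g r := by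
  simp only [radialMean]
  rw [← intervalIntegral.integral_add]
  · exact intervalIntegral.integral_congr fun t _ => by ring
  · exact Continuous.intervalIntegrable (by fun_prop) _ _
  · exact Continuous.intervalIntegrable (by fun_prop) _ _

/-- On `[0,1]` the weight is at most `1` and `r t ≤ r`, so averaging keeps a bound of order `r ^ k`.
The induction behind the factorial estimate relies on this. -/
theorem abs_radialMean_le (n k : ℕ) {f : ℝ → ℝ} {C : ℝ} (hC : 0 ≤ C)
    (h : ∀ r ∈ Icc (0 : ℝ) 1, |f r| ≤ C * r ^ k) {r : ℝ} (hr : r ∈ Icc (0 : ℝ) 1) :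
    |radialMean n f r| ≤ C * r ^ k := by
  have := intervalIntegral.norm_integral_le_of_norm_le_const (a := 0) (b := 1) (C := C * r ^ k)
    (f := fun t => t ^ n * f (r * t)) ?_
  · simpa [radialMean] using this
  · intro t ht
    rw [uIoc_of_le zero_le_one] at ht
    have h1 := h (r * t) ⟨mul_nonneg hr.1 ht.1.le, mul_le_one₀ hr.2 ht.1.le ht.2⟩
    rw [Real.norm_eq_abs, abs_mul, abs_of_nonneg (pow_nonneg ht.1.le n)]
    calc t ^ n * |f (r * t)| ≤ 1 * |f (r * t)| := by
          gcongr; exact pow_le_one₀ ht.1.le ht.2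
      _ ≤ C * (r * t) ^ k := by rw [one_mul]; exact h1
      _ ≤ C * r ^ k := by
          have h0 : 0 ≤ r * t := mul_nonneg hr.1 ht.1.le
          gcongr
          exact mul_le_of_le_one_right hr.1 ht.2

/-- Mere continuity of `f` suffices even at `0`: there the difference quotient is the mean itself,
with limit `f 0 / (n + 1)`. This is why the solutions are `C²` up to the singular end point. -/
theorem hasDerivAt_mul_radialMean (n : ℕ) {f : ℝ → ℝ} (hf : Continuous f) (r : ℝ) :
    HasDerivAt (fun x => x * radialMean n f x) (f r - n * radialMean n f r) r := by
  rcases eq_or_ne r 0 with rfl | hr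
  · rw [hasDerivAt_iff_tendsto_slope_zero]
    have h1 : f 0 - n * radialMean n f 0 = radialMean n f 0 := by
      rw [radialMean_zero]; field_simp; ring
    rw [h1]
    refine Tendsto.congr' ?_ ((continuous_radialMean n hf).continuousAt.tendsto.mono_left
      nhdsWithin_le_nhds)
    filter_upwards [self_mem_nhdsWithin] with t ht
    have ht : t ≠ 0 := ht
    simp [ht]
  · have hP : HasDerivAt (fun x => ∫ s in (0 : ℝ)..x, s ^ n * f s) (r ^ n * f r) r :=
      intervalIntegral.integral_hasDerivAt_right
        (Continuous.intervalIntegrable (by fun_prop) _ _)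
        (Continuous.stronglyMeasurableAtFilter (by fun_prop) _ _) (by fun_prop)
    have hd := hP.div (hasDerivAt_pow n r) (pow_ne_zero n hr)
    refine (hd.congr_of_eventuallyEq ?_).congr_deriv ?_
    · filter_upwards [isOpen_ne.mem_nhds hr] with x hx
      have hx : x ≠ 0 := hx
      rw [Pi.div_apply, ← pow_mul_radialMean]
      field_simp
      ring
    · rw [← pow_mul_radialMean]
      rcases n with _ | n
      · simp
      · simp only [Nat.add_sub_cancel]
        field_simp
        ring

/-! ### The Volterra operator and its powers -/

/-- The integral operator `f ↦ ∫₀ʳ s ∫₀¹ tⁿ b(st) f(st) dt ds` inverting the radial operator. -/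
noncomputable def volterra (n : ℕ) {b : ℝ → ℝ} (hb : Continuous b) :
    C(Icc (0 : ℝ) 1, ℝ) →ₗ[ℝ] C(Icc (0 : ℝ) 1, ℝ) where
  toFun f := ⟨fun r => ∫ s in (0 : ℝ)..r,
      s * radialMean n (fun x => b x * IccExtend zero_le_one f x) s, by
    have hc : Continuous (fun x => b x * IccExtend zero_le_one f x) :=
      hb.mul f.continuous.Icc_extend'
    have h2 : Continuous fun s => s * radialMean n (fun x => b x * IccExtend zero_le_one f x) s :=
      continuous_id.mul (continuous_radialMean n hc)
    exact (intervalIntegral.continuous_primitive (fun a b => h2.intervalIntegrable a b) 0).comp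
      continuous_subtype_val⟩
  map_add' f g := by
    ext r
    have hf : Continuous (fun x => b x * IccExtend zero_le_one f x) :=
      hb.mul f.continuous.Icc_extend'
    have hg : Continuous (fun x => b x * IccExtend zero_le_one g x) :=
      hb.mul g.continuous.Icc_extend'
    have h := intervalIntegral.integral_add (μ := MeasureTheory.volume)
      ((continuous_id'.mul (continuous_radialMean n hf)).intervalIntegrable 0 r)
      ((continuous_id'.mul (continuous_radialMean n hg)).intervalIntegrable 0 r)
    refine Eq.trans ?_ h
    refine intervalIntegral.integral_congr fun s _ => ?_
    have h2 := radialMean_add n hf hg s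
    simp only [IccExtend, Function.comp_apply, ContinuousMap.add_apply, ← mul_add] at h2 ⊢
    exact (congrArg (s * ·) h2).trans (mul_add _ _ _)
  map_smul' c f := by
    ext r
    refine Eq.trans ?_ (intervalIntegral.integral_const_mul c _)
    refine intervalIntegral.integral_congr fun s _ => ?_
    have h := radialMean_const_mul n (fun x => b x * IccExtend zero_le_one f x) c s
    simp only [IccExtend, Function.comp_apply, ContinuousMap.smul_apply, smul_eq_mul,
      mul_left_comm (b _) c] at h ⊢
    rw [h, mul_left_comm]

theorem volterra_apply (n : ℕ) {b : ℝ → ℝ} (hb : Continuous b) (f : C(Icc (0 : ℝ) 1, ℝ))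
    (r : Icc (0 : ℝ) 1) : volterra n hb f r = ∫ s in (0 : ℝ)..r,
      s * radialMean n (fun x => b x * IccExtend zero_le_one f x) s := rfl

/-- Each application gains a factor `A r / (k + 1)`; iteration produces the factorial. -/
theorem abs_volterra_le (n k : ℕ) {b : ℝ → ℝ} (hb : Continuous b) {A : ℝ}
    (hA : ∀ r ∈ Icc (0 : ℝ) 1, |b r| ≤ A) {C : ℝ} (hC : 0 ≤ C) {f : C(Icc (0 : ℝ) 1, ℝ)}
    (hf : ∀ r, |f r| ≤ C * (r : ℝ) ^ k) (r : Icc (0 : ℝ) 1) :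
    |volterra n hb f r| ≤ A * C / (k + 1) * (r : ℝ) ^ (k + 1) := by
  have hA0 : 0 ≤ A := (abs_nonneg _).trans (hA 0 (by simp))
  have hbound : ∀ s ∈ Icc (0 : ℝ) 1, |b s * IccExtend zero_le_one f s| ≤ A * C * s ^ k := by
    intro s hs
    rw [IccExtend_of_mem _ _ hs, abs_mul, mul_assoc]
    exact mul_le_mul (hA s hs) (hf ⟨s, hs⟩) (abs_nonneg _) hA0
  rw [volterra_apply]
  have := intervalIntegral.norm_integral_le_of_norm_le (μ := MeasureTheory.volume) r.2.1
    (f := fun s => s * radialMean n (fun x => b x * IccExtend zero_le_one f x) s)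
    (g := fun s => A * C * s ^ k) ?_ (Continuous.intervalIntegrable (by fun_prop) _ _)
  · refine this.trans (le_of_eq ?_)
    rw [intervalIntegral.integral_const_mul, integral_pow]
    simp
    ring
  · refine Eventually.of_forall fun s hs => ?_
    have hs' : s ∈ Icc (0 : ℝ) 1 := ⟨hs.1.le, hs.2.trans r.2.2⟩
    have h1 := abs_radialMean_le n k (by positivity) hbound hs'
    rw [Real.norm_eq_abs, abs_mul, abs_of_nonneg hs'.1]
    exact (mul_le_of_le_one_left (abs_nonneg _) hs'.2).trans h1

theorem exists_abs_le_of_continuous {b : ℝ → ℝ} (hb : Continuous b) :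
    ∃ A, ∀ r ∈ Icc (0 : ℝ) 1, |b r| ≤ A :=
  isCompact_Icc.exists_bound_of_continuousOn hb.continuousOn

/-- The operator `volterra` as a bounded operator on `C[0,1]`. -/
noncomputable def volterraCLM (n : ℕ) {b : ℝ → ℝ} (hb : Continuous b) :
    C(Icc (0 : ℝ) 1, ℝ) →L[ℝ] C(Icc (0 : ℝ) 1, ℝ) :=
  (volterra n hb).mkContinuousOfExistsBound <| by
    obtain ⟨A, hA⟩ := exists_abs_le_of_continuous hb
    have hA0 : 0 ≤ A := (abs_nonneg _).trans (hA 0 (by simp))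
    refine ⟨A, fun f => (ContinuousMap.norm_le _ (by positivity)).2 fun r => ?_⟩
    have h := abs_volterra_le n 0 hb hA (norm_nonneg f) (f := f)
      (fun r => by simpa using f.norm_coe_le_norm r) r
    refine h.trans ?_
    simpa using mul_le_of_le_one_right (by positivity : 0 ≤ A * ‖f‖) r.2.2

theorem volterraCLM_apply (n : ℕ) {b : ℝ → ℝ} (hb : Continuous b) (f : C(Icc (0 : ℝ) 1, ℝ))
    (r : Icc (0 : ℝ) 1) : volterraCLM n hb f r = ∫ s in (0 : ℝ)..r,
      s * radialMean n (fun x => b x * IccExtend zero_le_one f x) s := rfl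

theorem norm_volterraCLM_pow_le (n : ℕ) {b : ℝ → ℝ} (hb : Continuous b) {A : ℝ}
    (hA : ∀ r ∈ Icc (0 : ℝ) 1, |b r| ≤ A) (k : ℕ) :
    ‖volterraCLM n hb ^ k‖ ≤ A ^ k / k.factorial := by
  have hA0 : 0 ≤ A := (abs_nonneg _).trans (hA 0 (by simp))
  refine ContinuousLinearMap.opNorm_le_bound _ (by positivity) fun f => ?_
  -- The pointwise bound keeps the factor `r ^ k`, without which the induction would not yield the
  -- factorial.
  have key : ∀ r, |(volterraCLM n hb ^ k) f r| ≤ A ^ k / k.factorial * ‖f‖ * (r : ℝ) ^ k := by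
    induction k with
    | zero => intro r; simpa using f.norm_coe_le_norm r
    | succ k ih =>
      intro r
      rw [pow_succ']
      refine (abs_volterra_le n k hb hA (by positivity) ih r).trans (le_of_eq ?_)
      rw [Nat.factorial_succ]
      push_cast
      field_simp
      ring
  refine (ContinuousMap.norm_le _ (by positivity)).2 fun r => (key r).trans ?_
  exact mul_le_of_le_one_right (by positivity) (pow_le_one₀ r.2.1 r.2.2)

/-! ### Invertibility of `1 + m T` for every `m` -/

section Resolvent

variable {E : Type*} [NormedAddCommGroup E] [NormedSpace ℝ E] [CompleteSpace E]

/-- With `S = -m T`, the unit `1 - S ^ k` is the product of `1 - S` and a geometric sum. The two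
commute, so both are units. -/
theorem isUnit_one_add_smul_of_norm_pow_lt (T : E →L[ℝ] E) (m : ℝ) (k : ℕ)
    (h : |m| ^ k * ‖T ^ k‖ < 1) : IsUnit (1 + m • T) := by
  set S := (-m) • T with hSdef
  have hS : ‖S ^ k‖ < 1 := by
    rwa [hSdef, smul_pow, norm_smul, norm_pow, norm_neg, Real.norm_eq_abs]
  have hu := isUnit_one_sub_of_norm_lt_one hS
  rw [← mul_neg_geom_sum] at hu
  have hc : Commute (1 - S) (∑ i ∈ Finset.range k, S ^ i) := by
    rw [Commute, SemiconjBy, mul_neg_geom_sum, geom_sum_mul_neg]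
  have := (hc.isUnit_mul_iff.1 hu).1
  simpa [S] using this

theorem continuous_inverse_one_add_smul (T : E →L[ℝ] E) (hT : ∀ m : ℝ, IsUnit (1 + m • T)) (x : E) :
    Continuous fun m : ℝ => Ring.inverse (1 + m • T) x := by
  rw [continuous_iff_continuousAt]
  intro m
  have h1 : ContinuousAt (fun m : ℝ => Ring.inverse (1 + m • T)) m := by
    have := NormedRing.inverse_continuousAt (hT m).unit
    exact ContinuousAt.comp (f := fun m : ℝ => 1 + m • T) this (by fun_prop)
  exact h1.clm_apply continuousAt_const

end Resolvent

/-- `(|m| A) ^ k / k!` tends to `0`, so some power of `m T` is a contraction however large `m` is.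
-/
theorem isUnit_one_add_smul_volterraCLM (n : ℕ) {b : ℝ → ℝ} (hb : Continuous b) (m : ℝ) :
    IsUnit (1 + m • volterraCLM n hb) := by
  obtain ⟨A, hA⟩ := exists_abs_le_of_continuous hb
  obtain ⟨k, hk⟩ := ((FloorSemiring.tendsto_pow_div_factorial_atTop (|m| * A)).eventually
    (gt_mem_nhds zero_lt_one)).exists
  refine isUnit_one_add_smul_of_norm_pow_lt _ m k (lt_of_le_of_lt ?_ hk)
  rw [mul_pow, mul_div_assoc]
  gcongr
  exact norm_volterraCLM_pow_le n hb hA k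

/-- The solution in `C[0,1]` of `u = 1 - m T u`, where `T` is `volterraCLM`. -/
noncomputable def solution (n : ℕ) {b : ℝ → ℝ} (hb : Continuous b) (m : ℝ) :
    C(Icc (0 : ℝ) 1, ℝ) :=
  Ring.inverse (1 + m • volterraCLM n hb) 1

theorem continuous_solution (n : ℕ) {b : ℝ → ℝ} (hb : Continuous b) :
    Continuous (solution n hb) :=
  continuous_inverse_one_add_smul _ (isUnit_one_add_smul_volterraCLM n hb) 1

theorem solution_eq (n : ℕ) {b : ℝ → ℝ} (hb : Continuous b) (m : ℝ) :
    solution n hb m = 1 - m • volterraCLM n hb (solution n hb m) := by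
  have h := Ring.mul_inverse_cancel _ (isUnit_one_add_smul_volterraCLM n hb m)
  have h2 := congrArg (fun L => L (1 : C(Icc (0 : ℝ) 1, ℝ))) h
  simp only [mul_apply_eq_comp, one_apply_eq_self,
    add_apply, smul_apply] at h2
  exact eq_sub_of_add_eq h2

theorem eq_smul_solution (n : ℕ) {b : ℝ → ℝ} (hb : Continuous b) (m c : ℝ)
    {f : C(Icc (0 : ℝ) 1, ℝ)} (hf : f = c • 1 - m • volterraCLM n hb f) :
    f = c • solution n hb m := by
  have h := Ring.inverse_mul_cancel _ (isUnit_one_add_smul_volterraCLM n hb m)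
  have h2 := congrArg (fun L => L f) h
  have h3 : (1 + m • volterraCLM n hb) f = c • 1 := by
    simp only [one_apply_eq_self,
      add_apply, smul_apply]
    exact eq_sub_iff_add_eq.1 hf
  rw [mul_apply_eq_comp, h3, map_smul, one_apply_eq_self] at h2
  exact h2.symm

/-! ### The singular Cauchy problem: existence, regularity, uniqueness -/

section

variable (n : ℕ) {b : ℝ → ℝ} (hb : Continuous b) (m : ℝ)

/-- The continuous function `b u` on the line, `u` being `solution` extended by constants. -/
noncomputable def source (r : ℝ) : ℝ := b r * IccExtend zero_le_one (solution n hb m) r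

theorem continuous_IccExtend_solution :
    Continuous (Function.uncurry fun m r => IccExtend zero_le_one (solution n hb m) r) := by
  have h : Continuous fun p : ℝ × ℝ => (solution n hb p.1) (projIcc 0 1 zero_le_one p.2) :=
    ((continuous_solution n hb).comp continuous_fst).eval
      (continuous_projIcc.comp continuous_snd)
  exact h

theorem continuous_uncurry_source : Continuous (Function.uncurry (source n hb)) :=
  (hb.comp continuous_snd).mul (continuous_IccExtend_solution n hb)

theorem continuous_source : Continuous (source n hb m) :=
  (continuous_uncurry_source n hb).comp (by fun_prop : Continuous fun r : ℝ => (m, r))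

/-- The weighted mean of `source`; the radial solution has derivative `-m r * sourceMean r`. -/
noncomputable def sourceMean (r : ℝ) : ℝ := radialMean n (source n hb m) r

theorem continuous_uncurry_sourceMean : Continuous (Function.uncurry (sourceMean n hb)) :=
  continuous_radialMean_param n (continuous_uncurry_source n hb)

theorem continuous_sourceMean : Continuous (sourceMean n hb m) :=
  continuous_radialMean n (continuous_source n hb m)

theorem hasDerivAt_mul_sourceMean (r : ℝ) : HasDerivAt (fun x => x * sourceMean n hb m x)
    (source n hb m r - n * sourceMean n hb m r) r :=
  hasDerivAt_mul_radialMean n (continuous_source n hb m) r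

/-- The solution of `u'' + (n / r) u' = -m b u` with `u(0) = 1`, `u'(0) = 0` on `[0,1]`, extended
to a function of class `C²` on the line. -/
noncomputable def radialSolution (r : ℝ) : ℝ :=
  1 - m * ∫ s in (0 : ℝ)..r, s * sourceMean n hb m s

theorem radialSolution_zero : radialSolution n hb m 0 = 1 := by simp [radialSolution]

theorem radialSolution_param_zero (r : ℝ) : radialSolution n hb 0 r = 1 := by
  simp [radialSolution]

theorem hasDerivAt_radialSolution (r : ℝ) :
    HasDerivAt (radialSolution n hb m) (-m * (r * sourceMean n hb m r)) r := by
  have hc : Continuous fun s => s * sourceMean n hb m s :=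
    continuous_id.mul (continuous_sourceMean n hb m)
  have h := intervalIntegral.integral_hasDerivAt_right (hc.intervalIntegrable 0 r)
    (hc.stronglyMeasurableAtFilter _ _) hc.continuousAt
  exact ((h.const_mul m).const_sub 1).congr_deriv (by ring)

theorem continuous_radialSolution : Continuous (radialSolution n hb m) :=
  continuous_iff_continuousAt.2 fun r => (hasDerivAt_radialSolution n hb m r).continuousAt

theorem radialSolution_eq_solution {r : ℝ} (hr : r ∈ Icc (0 : ℝ) 1) :
    radialSolution n hb m r = solution n hb m ⟨r, hr⟩ := by
  have h := congrArg (fun f => f ⟨r, hr⟩) (solution_eq n hb m)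
  simp only [ContinuousMap.sub_apply, ContinuousMap.one_apply, ContinuousMap.smul_apply,
    smul_eq_mul, volterraCLM_apply] at h
  exact h.symm

theorem source_eq {r : ℝ} (hr : r ∈ Icc (0 : ℝ) 1) :
    source n hb m r = b r * radialSolution n hb m r := by
  rw [source, radialSolution_eq_solution n hb m hr, IccExtend_of_mem _ _ hr]

theorem deriv_radialSolution :
    deriv (radialSolution n hb m) = fun r => -m * (r * sourceMean n hb m r) :=
  funext fun r => (hasDerivAt_radialSolution n hb m r).deriv

theorem hasDerivAt_deriv_radialSolution (r : ℝ) : HasDerivAt (deriv (radialSolution n hb m))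
    (-m * (source n hb m r - n * sourceMean n hb m r)) r := by
  rw [deriv_radialSolution]
  exact (hasDerivAt_mul_sourceMean n hb m r).const_mul _

theorem contDiff_radialSolution : ContDiff ℝ 2 (radialSolution n hb m) := by
  rw [show (2 : WithTop ℕ∞) = 1 + 1 by norm_num, contDiff_succ_iff_deriv]
  refine ⟨fun r => (hasDerivAt_radialSolution n hb m r).differentiableAt, by simp, ?_⟩
  rw [contDiff_one_iff_deriv]
  refine ⟨fun r => (hasDerivAt_deriv_radialSolution n hb m r).differentiableAt, ?_⟩
  have : deriv (deriv (radialSolution n hb m)) =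
      fun r => -m * (source n hb m r - n * sourceMean n hb m r) :=
    funext fun r => (hasDerivAt_deriv_radialSolution n hb m r).deriv
  rw [this]
  have := continuous_source n hb m
  have := continuous_sourceMean n hb m
  fun_prop

theorem derivWithin_radialSolution {r : ℝ} (hr : r ∈ Icc (0 : ℝ) 1) :
    derivWithin (radialSolution n hb m) (Icc 0 1) r = -m * (r * sourceMean n hb m r) :=
  (hasDerivAt_radialSolution n hb m r).hasDerivWithinAt.derivWithin
    (uniqueDiffOn_Icc zero_lt_one r hr)

theorem radialSolution_equation {r : ℝ} (hr : r ∈ Ioc (0 : ℝ) 1) :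
    -(deriv (deriv (radialSolution n hb m)) r) -
      (((n + 1 : ℕ) : ℝ) - 1) / r * deriv (radialSolution n hb m) r =
        m * b r * radialSolution n hb m r := by
  rw [(hasDerivAt_deriv_radialSolution n hb m r).deriv,
    source_eq n hb m ⟨hr.1.le, hr.2⟩, deriv_radialSolution]
  have := hr.1.ne'
  push_cast
  field_simp
  ring

theorem isNeumannSolution_radialSolution (h1 : m * sourceMean n hb m 1 = 0) :
    IsNeumannSolution (n + 1) b m (radialSolution n hb m) where
  contDiffOn := (contDiff_radialSolution n hb m).contDiffOn
  equation r hr := radialSolution_equation n hb m ⟨hr.1, hr.2.le⟩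
  neumann_zero := by rw [derivWithin_radialSolution _ _ _ (by simp)]; simp
  neumann_one := by rw [derivWithin_radialSolution _ _ _ (by simp)]; simpa using h1

variable {n m} in
/-- Solutions of the Cauchy problem at the singular end point are unique. -/
theorem eq_mul_radialSolution {u : ℝ → ℝ} (hu : ContDiffOn ℝ 2 u (Icc 0 1))
    (heq : ∀ r ∈ Ioo (0 : ℝ) 1,
      -(deriv (deriv u) r) - (((n + 1 : ℕ) : ℝ) - 1) / r * deriv u r = m * b r * u r)
    (h0 : derivWithin u (Icc 0 1) 0 = 0) {r : ℝ} (hr : r ∈ Icc (0 : ℝ) 1) :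
    u r = u 0 * radialSolution n hb m r := by
  set w := derivWithin u (Icc 0 1) with hw
  have hwC : ContDiffOn ℝ 1 w (Icc 0 1) :=
    hu.derivWithin (uniqueDiffOn_Icc zero_lt_one) (by norm_num)
  have hnhds : ∀ r ∈ Ioo (0 : ℝ) 1, Icc (0 : ℝ) 1 ∈ 𝓝 r := fun r hr => Icc_mem_nhds hr.1 hr.2
  have hwd : ∀ r ∈ Ioo (0 : ℝ) 1, w r = deriv u r := fun r hr =>
    derivWithin_of_mem_nhds (hnhds r hr)
  have hud : ∀ r ∈ Ioo (0 : ℝ) 1, HasDerivAt u (w r) r := fun r hr => by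
    rw [hwd r hr]
    exact ((hu.differentiableOn (by norm_num)).differentiableAt (hnhds r hr)).hasDerivAt
  have hwdd : ∀ r ∈ Ioo (0 : ℝ) 1, HasDerivAt w (-(n / r) * w r - m * b r * u r) r :=
    fun r hr => by
    have h1 := ((hwC.differentiableOn (by norm_num)).differentiableAt (hnhds r hr)).hasDerivAt
    have h2 : deriv w r = deriv (deriv u) r := by
      refine Filter.EventuallyEq.deriv_eq ?_
      filter_upwards [isOpen_Ioo.mem_nhds hr] with x hx using hwd x hx
    refine h1.congr_deriv ?_
    have h3 := heq r hr
    rw [h2, hwd r hr]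
    push_cast at h3
    linear_combination -h3
  set F : C(Icc (0 : ℝ) 1, ℝ) := ⟨fun r => u r, hu.continuousOn.domRestrict⟩ with hF
  set f : ℝ → ℝ := fun x => b x * IccExtend zero_le_one F x with hf
  have hfc : Continuous f := hb.mul F.continuous.Icc_extend'
  have hfe : ∀ r ∈ Icc (0 : ℝ) 1, f r = b r * u r := fun r hr => by
    rw [hf]; simp only; rw [IccExtend_of_mem _ _ hr]; rfl
  -- first integration
  have hint : ∀ r ∈ Icc (0 : ℝ) 1, w r = -m * (r * radialMean n f r) := by
    intro r hr
    rcases hr.1.eq_or_lt with rfl | hr0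
    · simp [h0]
    -- The integrating factor `xⁿ` removes the singular term: `(xⁿ w)' = -m xⁿ f`.
    have h := intervalIntegral.integral_eq_sub_of_hasDerivAt_of_le hr.1
      (f := fun x => x ^ n * w x) (f' := fun x => -m * (x ^ n * f x))
      (((continuous_pow n).continuousOn).mul (hwC.continuousOn.mono (Icc_subset_Icc_right hr.2)))
      (fun x hx => ?_) (Continuous.intervalIntegrable (by fun_prop) _ _)
    · rw [intervalIntegral.integral_const_mul, ← pow_mul_radialMean, h0] at h
      have hp : r ^ n ≠ 0 := (pow_pos hr0 n).ne'
      refine mul_left_cancel₀ hp ?_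
      simp only [mul_zero, sub_zero] at h
      rw [← h]
      ring
    · have hx' : x ∈ Ioo (0 : ℝ) 1 := ⟨hx.1, hx.2.trans_le hr.2⟩
      refine ((hasDerivAt_pow n x).mul (hwdd x hx')).congr_deriv ?_
      rw [hfe x ⟨hx'.1.le, hx'.2.le⟩]
      have hx0 := hx.1.ne'
      rcases n with _ | k
      · simp
        ring
      · simp only [Nat.add_sub_cancel, pow_succ]
        field_simp
        ring
  have hgc : Continuous fun s => s * radialMean n f s :=
    continuous_id.mul (continuous_radialMean n hfc)
  -- The second integration gives the fixed point equation, whose solution is unique by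
  -- invertibility of `1 + m T`.
  have hsol : F = (u 0) • 1 - m • volterraCLM n hb F := by
    ext ⟨r, hr⟩
    have h := intervalIntegral.integral_eq_sub_of_hasDerivAt_of_le hr.1
      (f := u) (f' := fun x => -m * (x * radialMean n f x))
      (hu.continuousOn.mono (Icc_subset_Icc_right hr.2))
      (fun x hx => ?_) (Continuous.intervalIntegrable (by fun_prop) _ _)
    · rw [intervalIntegral.integral_const_mul] at h
      simp only [ContinuousMap.sub_apply, ContinuousMap.smul_apply, ContinuousMap.one_apply,
        smul_eq_mul, volterraCLM_apply]
      simp only [hF]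
      linear_combination -h
    · have hx' : x ∈ Ioo (0 : ℝ) 1 := ⟨hx.1, hx.2.trans_le hr.2⟩
      rw [← hint x ⟨hx'.1.le, hx'.2.le⟩]
      exact hud x hx'
  have h := congrArg (fun f => f ⟨r, hr⟩) (eq_smul_solution n hb m (u 0) hsol)
  simp only [ContinuousMap.smul_apply, smul_eq_mul] at h
  rw [radialSolution_eq_solution n hb m hr, ← h]
  rfl

end

/-! ### Prüfer coordinates for `m = l ^ 2` -/

section

variable (n : ℕ) {b : ℝ → ℝ} (hb : Continuous b) (l : ℝ)

theorem continuous_uncurry_radialSolution :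
    Continuous (Function.uncurry (radialSolution n hb)) := by
  have h := intervalIntegral.continuous_parametric_intervalIntegral_of_continuous
    (X := ℝ × ℝ) (μ := MeasureTheory.volume) (a₀ := 0) (s := Prod.snd)
    (f := fun p s => s * sourceMean n hb p.1 s) ?_ continuous_snd
  · exact continuous_const.sub (continuous_fst.mul h)
  · exact continuous_snd.mul ((continuous_uncurry_sourceMean n hb).comp
      (by fun_prop : Continuous fun q : (ℝ × ℝ) × ℝ => (q.1.1, q.2)))

/-- The radial solution for the parameter `m = l ^ 2`. -/
noncomputable def pruferU (r : ℝ) : ℝ := radialSolution n hb (l ^ 2) r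

/-- The function `-u' / l`, where `u` is the radial solution for the parameter `m = l ^ 2`. -/
noncomputable def pruferY (r : ℝ) : ℝ := l * (r * sourceMean n hb (l ^ 2) r)

/-- The derivative of `pruferY`. -/
noncomputable def pruferDY (r : ℝ) : ℝ :=
  l * (source n hb (l ^ 2) r - n * sourceMean n hb (l ^ 2) r)

theorem continuous_uncurry_pruferU : Continuous (Function.uncurry (pruferU n hb)) :=
  (continuous_uncurry_radialSolution n hb).comp
    (by fun_prop : Continuous fun p : ℝ × ℝ => (p.1 ^ 2, p.2))

theorem continuous_uncurry_pruferY : Continuous (Function.uncurry (pruferY n hb)) :=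
  continuous_fst.mul (continuous_snd.mul ((continuous_uncurry_sourceMean n hb).comp
    (by fun_prop : Continuous fun p : ℝ × ℝ => (p.1 ^ 2, p.2))))

theorem continuous_uncurry_pruferDY : Continuous (Function.uncurry (pruferDY n hb)) := by
  have hc : Continuous fun p : ℝ × ℝ => (p.1 ^ 2, p.2) := by fun_prop
  exact continuous_fst.mul (((continuous_uncurry_source n hb).comp hc).sub
    (continuous_const.mul ((continuous_uncurry_sourceMean n hb).comp hc)))

theorem pruferU_zero : pruferU n hb l 0 = 1 := radialSolution_zero n hb _

theorem pruferY_zero : pruferY n hb l 0 = 0 := by simp [pruferY]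

theorem hasDerivAt_pruferU (r : ℝ) :
    HasDerivAt (pruferU n hb l) (-l * pruferY n hb l r) r :=
  (hasDerivAt_radialSolution n hb (l ^ 2) r).congr_deriv (by rw [pruferY]; ring)

theorem hasDerivAt_pruferY (r : ℝ) : HasDerivAt (pruferY n hb l) (pruferDY n hb l r) r :=
  (hasDerivAt_mul_sourceMean n hb (l ^ 2) r).const_mul l

theorem pruferDY_zero : pruferDY n hb l 0 = l * b 0 / (n + 1) := by
  have h : source n hb (l ^ 2) 0 = b 0 := by
    rw [source_eq n hb _ (by simp), radialSolution_zero, mul_one]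
  rw [pruferDY, sourceMean, radialMean_zero, h]
  field_simp
  ring

theorem mul_pruferDY {r : ℝ} (hr : r ∈ Icc (0 : ℝ) 1) :
    r * pruferDY n hb l r = l * r * b r * pruferU n hb l r - n * pruferY n hb l r := by
  rw [pruferDY, source_eq n hb _ hr, pruferY, pruferU]
  ring

/-- The square of the Prüfer radius. -/
noncomputable def pruferE (r : ℝ) : ℝ := pruferU n hb l r ^ 2 + pruferY n hb l r ^ 2

theorem hasDerivAt_pruferE (r : ℝ) : HasDerivAt (pruferE n hb l)
    (2 * pruferY n hb l r * (pruferDY n hb l r - l * pruferU n hb l r)) r := by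
  refine (((hasDerivAt_pruferU n hb l r).pow 2).add
    ((hasDerivAt_pruferY n hb l r).pow 2)).congr_deriv ?_
  simp
  ring

/-- `r^{2n} e^{Cr} E` is nondecreasing: the power compensates the damping `-2n Y²/r` in `E'`, and
the exponential compensates `2 l (b - 1) U Y`. Since `E(0) = 1`, this product is positive just right
of `0` and cannot vanish later. -/
theorem pruferE_pos {r : ℝ} (hr : r ∈ Icc (0 : ℝ) 1) : 0 < pruferE n hb l r := by
  obtain ⟨A, hA⟩ := exists_abs_le_of_continuous hb
  set C := |l| * (A + 1) with hC
  set M : ℝ → ℝ := fun r => r ^ (2 * n) * Real.exp (C * r) * pruferE n hb l r with hM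
  have hMd : ∀ x, HasDerivAt M (((2 * n : ℕ) * x ^ (2 * n - 1) * Real.exp (C * x) +
      x ^ (2 * n) * (Real.exp (C * x) * C)) * pruferE n hb l x + x ^ (2 * n) * Real.exp (C * x) *
      (2 * pruferY n hb l x * (pruferDY n hb l x - l * pruferU n hb l x))) x := fun x => by
    have he : HasDerivAt (fun x => Real.exp (C * x)) (Real.exp (C * x) * C) x :=
      ((hasDerivAt_id x).const_mul C).exp.congr_deriv (by simp)
    exact ((hasDerivAt_pow (2 * n) x).mul he).mul (hasDerivAt_pruferE n hb l x)
  have hmono : MonotoneOn M (Icc 0 1) := by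
    refine monotoneOn_of_deriv_nonneg (convex_Icc 0 1)
      (fun x _ => (hMd x).continuousAt.continuousWithinAt)
      (fun x _ => (hMd x).differentiableAt.differentiableWithinAt) fun x hx => ?_
    rw [interior_Icc] at hx
    rw [(hMd x).deriv]
    set U := pruferU n hb l x
    set Y := pruferY n hb l x
    have hE : pruferE n hb l x = U ^ 2 + Y ^ 2 := rfl
    have hDY : x * pruferDY n hb l x = l * x * b x * U - n * Y :=
      mul_pruferDY n hb l ⟨hx.1.le, hx.2.le⟩
    -- Multiplying by `x` makes the truncated exponent `2 * n - 1` harmless when `n = 0`.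
    have hpow : ((2 * n : ℕ) : ℝ) * x ^ (2 * n - 1) * x = 2 * n * x ^ (2 * n) := by
      rcases n with _ | k
      · simp
      · rw [mul_assoc, ← pow_succ]; push_cast; congr 2
    have hcC : |l * (b x - 1)| ≤ C := by
      rw [abs_mul]
      have h1 := abs_sub (b x) 1
      rw [abs_one] at h1
      exact mul_le_mul_of_nonneg_left (by linarith [hA x ⟨hx.1.le, hx.2.le⟩]) (abs_nonneg l)
    have hcC' := abs_le.1 hcC
    refine le_of_mul_le_mul_left (a := x) ?_ hx.1
    rw [mul_zero]
    have key : x * ((((2 * n : ℕ) : ℝ) * x ^ (2 * n - 1) * Real.exp (C * x) +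
      x ^ (2 * n) * (Real.exp (C * x) * C)) * pruferE n hb l x + x ^ (2 * n) * Real.exp (C * x) *
      (2 * Y * (pruferDY n hb l x - l * U))) =
      Real.exp (C * x) * x ^ (2 * n) * (2 * n * U ^ 2 +
        x * ((C + l * (b x - 1)) * (U + Y) ^ 2 / 2 + (C - l * (b x - 1)) * (U - Y) ^ 2 / 2)) := by
      rw [hE]
      linear_combination Real.exp (C * x) * (U ^ 2 + Y ^ 2) * hpow +
        x ^ (2 * n) * Real.exp (C * x) * 2 * Y * hDY
    rw [key]
    have h1 : 0 ≤ C + l * (b x - 1) := by linarith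
    have h2 : 0 ≤ C - l * (b x - 1) := by linarith
    have h3 := hx.1
    positivity
  have hnn : 0 ≤ pruferE n hb l r := by unfold pruferE; positivity
  refine hnn.lt_of_ne' fun h0 => ?_
  have hev : ∀ᶠ x in 𝓝 (0 : ℝ), 0 < pruferE n hb l x := by
    refine (hasDerivAt_pruferE n hb l 0).continuousAt.eventually (lt_mem_nhds ?_)
    simp [pruferE, pruferU_zero, pruferY_zero]
  have hr0 : 0 < r := by
    refine hr.1.lt_of_ne ?_
    rintro rfl
    exact hev.self_of_nhds.ne' h0
  obtain ⟨x, hx, hx0, hxr⟩ := ((hev.filter_mono nhdsWithin_le_nhds).and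
    (Ioo_mem_nhdsGT hr0)).exists
  have h1 := hmono ⟨hx0.le, hxr.le.trans hr.2⟩ hr hxr.le
  have h2 : 0 < M x := by simp only [hM]; positivity
  have h3 : M r = 0 := by simp only [hM, h0, mul_zero]
  linarith

/-- The derivative of the Prüfer angle on `[0,1]`. -/
noncomputable def angularSpeed (r : ℝ) : ℝ :=
  (pruferU n hb l r * pruferDY n hb l r + l * pruferY n hb l r ^ 2) / pruferE n hb l r

/-- The Prüfer angle, the continuous argument of `u - i u' / l` on `[0,1]`. -/
noncomputable def pruferAngle (r : ℝ) : ℝ :=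
  ∫ s in (0 : ℝ)..r, angularSpeed n hb l (projIcc 0 1 zero_le_one s)

/-- `E` is known to be positive only on `[0,1]`. Freezing the speed outside keeps the integrand
continuous on the line, so the angle has two-sided derivatives at the end points. -/
theorem continuous_angularSpeed_projIcc : Continuous (Function.uncurry fun (l s : ℝ) =>
    angularSpeed n hb l (projIcc 0 1 zero_le_one s)) := by
  have hc : Continuous fun p : ℝ × ℝ => (p.1, (projIcc (0 : ℝ) 1 zero_le_one p.2 : ℝ)) :=
    continuous_fst.prodMk (continuous_subtype_val.comp (continuous_projIcc.comp continuous_snd))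
  have hU := (continuous_uncurry_pruferU n hb).comp hc
  have hY := (continuous_uncurry_pruferY n hb).comp hc
  have hDY := (continuous_uncurry_pruferDY n hb).comp hc
  refine Continuous.div ((hU.mul hDY).add (continuous_fst.mul (hY.pow 2)))
    ((hU.pow 2).add (hY.pow 2)) fun p => ?_
  exact (pruferE_pos n hb p.1 (projIcc 0 1 zero_le_one p.2).2).ne'

theorem continuous_pruferAngle_param (r : ℝ) : Continuous fun l => pruferAngle n hb l r :=
  intervalIntegral.continuous_parametric_intervalIntegral_of_continuous'
    (continuous_angularSpeed_projIcc n hb) 0 r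

theorem pruferAngle_zero : pruferAngle n hb l 0 = 0 := by simp [pruferAngle]

theorem pruferAngle_param_zero (r : ℝ) : pruferAngle n hb 0 r = 0 := by
  simp [pruferAngle, angularSpeed, pruferDY]

theorem hasDerivAt_pruferAngle {r : ℝ} (hr : r ∈ Icc (0 : ℝ) 1) :
    HasDerivAt (pruferAngle n hb l) (angularSpeed n hb l r) r := by
  have hc : Continuous fun s : ℝ => angularSpeed n hb l (projIcc 0 1 zero_le_one s) :=
    (continuous_angularSpeed_projIcc n hb).comp (by fun_prop : Continuous fun s : ℝ => (l, s))
  have h := intervalIntegral.integral_hasDerivAt_right (hc.intervalIntegrable 0 r)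
    (hc.stronglyMeasurableAtFilter _ _) hc.continuousAt
  rwa [projIcc_of_mem _ hr] at h

theorem continuousOn_pruferAngle : ContinuousOn (pruferAngle n hb l) (Icc 0 1) :=
  fun _ hr => (hasDerivAt_pruferAngle n hb l hr).continuousAt.continuousWithinAt

/-- The quotient `Q` is the squared sine of the gap between the integrated angle and the direction
of `(U, Y)`. Its derivative vanishes and `Q 0 = 0`. Agreement modulo `π` is enough to locate zeros,
so no polar lift is needed. -/
theorem pruferY_mul_cos {r : ℝ} (hr : r ∈ Icc (0 : ℝ) 1) :
    pruferY n hb l r * Real.cos (pruferAngle n hb l r) =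
      pruferU n hb l r * Real.sin (pruferAngle n hb l r) := by
  set Q : ℝ → ℝ := fun r => (pruferY n hb l r * Real.cos (pruferAngle n hb l r) -
      pruferU n hb l r * Real.sin (pruferAngle n hb l r)) ^ 2 / pruferE n hb l r with hQ
  have hQd : ∀ x ∈ Icc (0 : ℝ) 1, HasDerivAt Q 0 x := fun x hx => by
    have hE := pruferE_pos n hb l hx
    have hθ := hasDerivAt_pruferAngle n hb l hx
    refine ((((hasDerivAt_pruferY n hb l x).mul hθ.cos).sub
      ((hasDerivAt_pruferU n hb l x).mul hθ.sin)).pow 2).div (hasDerivAt_pruferE n hb l x)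
      hE.ne' |>.congr_deriv ?_
    have hs : angularSpeed n hb l x * pruferE n hb l x =
        pruferU n hb l x * pruferDY n hb l x + l * pruferY n hb l x ^ 2 :=
      div_mul_cancel₀ _ hE.ne'
    rw [div_eq_zero_iff]
    left
    simp only [Pi.sub_apply, Pi.mul_apply, Pi.pow_apply]
    set D := angularSpeed n hb l x
    have hEE : pruferE n hb l x = pruferU n hb l x ^ 2 + pruferY n hb l x ^ 2 := rfl
    rw [hEE] at hs ⊢
    set U := pruferU n hb l x
    set Y := pruferY n hb l x
    set c := Real.cos (pruferAngle n hb l x)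
    set s := Real.sin (pruferAngle n hb l x)
    push_cast
    linear_combination (-2 * (Y * c - U * s) * (Y * s + U * c)) * hs
  have h := constant_of_has_deriv_right_zero
    (fun x hx => (hQd x hx).continuousAt.continuousWithinAt)
    (fun x hx => (hQd x ⟨hx.1, hx.2.le⟩).hasDerivWithinAt) r hr
  have h0 : Q 0 = 0 := by simp [hQ, pruferY_zero, pruferAngle_zero]
  rw [h0] at h
  have h2 := (div_eq_zero_iff.1 h).resolve_right (pruferE_pos n hb l hr).ne'
  exact sub_eq_zero.1 (pow_eq_zero_iff two_ne_zero |>.1 h2)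

theorem pruferU_eq_zero_iff {r : ℝ} (hr : r ∈ Icc (0 : ℝ) 1) :
    pruferU n hb l r = 0 ↔ Real.cos (pruferAngle n hb l r) = 0 := by
  have h := pruferY_mul_cos n hb l hr
  have hE := pruferE_pos n hb l hr
  have hcs := Real.sin_sq_add_cos_sq (pruferAngle n hb l r)
  constructor <;> intro h0 <;> rw [h0] at h
  · simp only [zero_mul, mul_eq_zero] at h
    refine h.resolve_left fun hY => hE.ne' (by simp [pruferE, h0, hY])
  · rw [h0] at hcs
    simp only [mul_zero, zero_eq_mul] at h
    refine h.resolve_right fun hs => ?_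
    simp [hs] at hcs

theorem pruferY_eq_zero_iff {r : ℝ} (hr : r ∈ Icc (0 : ℝ) 1) :
    pruferY n hb l r = 0 ↔ Real.sin (pruferAngle n hb l r) = 0 := by
  have h := pruferY_mul_cos n hb l hr
  have hE := pruferE_pos n hb l hr
  have hcs := Real.sin_sq_add_cos_sq (pruferAngle n hb l r)
  constructor <;> intro h0 <;> rw [h0] at h
  · simp only [zero_mul, zero_eq_mul] at h
    refine h.resolve_left fun hY => hE.ne' (by simp [pruferE, h0, hY])
  · rw [h0] at hcs
    simp only [mul_zero, mul_eq_zero] at h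
    refine h.resolve_right fun hs => ?_
    simp [hs] at hcs

theorem angularSpeed_zero : angularSpeed n hb l 0 = l * b 0 / (n + 1) := by
  simp [angularSpeed, pruferE, pruferU_zero, pruferY_zero, pruferDY_zero]

theorem angularSpeed_eq {r : ℝ} (hr : r ∈ Ioc (0 : ℝ) 1) : angularSpeed n hb l r =
    l * (Real.sin (pruferAngle n hb l r) ^ 2 + b r * Real.cos (pruferAngle n hb l r) ^ 2) -
      n / r * (Real.sin (pruferAngle n hb l r) * Real.cos (pruferAngle n hb l r)) := by
  have hr' : r ∈ Icc (0 : ℝ) 1 := ⟨hr.1.le, hr.2⟩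
  have h := pruferY_mul_cos n hb l hr'
  have hE := pruferE_pos n hb l hr'
  have hDY := mul_pruferDY n hb l hr'
  have hcs := Real.sin_sq_add_cos_sq (pruferAngle n hb l r)
  rw [angularSpeed, div_eq_iff hE.ne']
  have hr0 := hr.1.ne'
  have hDY' : pruferDY n hb l r = l * b r * pruferU n hb l r - n / r * pruferY n hb l r := by
    field_simp
    linear_combination hDY
  rw [hDY']
  have hEE : pruferE n hb l r = pruferU n hb l r ^ 2 + pruferY n hb l r ^ 2 := rfl
  rw [hEE]
  set U := pruferU n hb l r
  set Y := pruferY n hb l r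
  set c := Real.cos (pruferAngle n hb l r)
  set s := Real.sin (pruferAngle n hb l r)
  -- Only quadratic expressions in `U`, `Y` enter, so the sign of the Prüfer radius plays no role.
  have h1 : U ^ 2 = (U ^ 2 + Y ^ 2) * c ^ 2 := by
    linear_combination (-U ^ 2) * hcs - (Y * c + U * s) * h
  have h2 : Y ^ 2 = (U ^ 2 + Y ^ 2) * s ^ 2 := by
    linear_combination (-Y ^ 2) * hcs + (Y * c + U * s) * h
  have h3 : U * Y = (U ^ 2 + Y ^ 2) * (s * c) := by
    linear_combination (-U * Y) * hcs + (U * c - Y * s) * h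
  linear_combination l * b r * h1 + l * h2 - n / r * h3

end

/-! ### One-way crossings: monotonicity in `l` and counting of zeros -/

section

/-- A function with positive derivative wherever it takes the value `c` crosses this level at most
once, and upwards. -/
theorem lt_of_deriv_pos_at_level {f f' : ℝ → ℝ} {c a b : ℝ}
    (hf : ∀ x ∈ Icc a b, HasDerivAt f (f' x) x) (hpos : ∀ x ∈ Icc a b, f x = c → 0 < f' x)
    (ha : c ≤ f a) {x : ℝ} (hx : x ∈ Ioc a b) : c < f x := by
  have hle : ∀ ⦃x⦄, x ∈ Icc a b → c ≤ f x :=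
    image_le_of_deriv_right_lt_deriv_boundary' (f := fun _ => c) (f' := fun _ => 0)
      continuousOn_const (fun x _ => hasDerivWithinAt_const x _ c) ha
      (fun x hx => (hf x hx).continuousAt.continuousWithinAt)
      (fun x hx => (hf x ⟨hx.1, hx.2.le⟩).hasDerivWithinAt)
      fun x hx h => hpos x ⟨hx.1, hx.2.le⟩ h.symm
  -- Equality at `x` with a positive derivative would put `f` below `c` just to the left of `x`,
  -- against `hle`.
  refine (hle ⟨hx.1.le, hx.2⟩).lt_of_ne fun h => ?_
  have hd := hasDerivAt_iff_tendsto_slope.1 (hf x ⟨hx.1.le, hx.2⟩)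
  have hev := hd.eventually (lt_mem_nhds (hpos x ⟨hx.1.le, hx.2⟩ h.symm))
  have hlt : 𝓝[<] x ≤ 𝓝[≠] x := nhdsWithin_mono x fun y hy => ne_of_lt hy
  obtain ⟨y, hy, hay, hyx⟩ := ((hev.filter_mono hlt).and (Ioo_mem_nhdsLT hx.1)).exists
  rw [slope_def_field] at hy
  have h1 : f y < f x := by
    by_contra! h2
    exact absurd hy (not_lt.2 (div_nonpos_of_nonneg_of_nonpos (by linarith) (by linarith)))
  have := hle ⟨hay.le, hyx.le.trans hx.2⟩
  linarith

variable (n : ℕ) {b : ℝ → ℝ} (hb : Continuous b) (l : ℝ)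

theorem sin_sq_add_mul_cos_sq_pos {β : ℝ} (hβ : 0 < β) (x : ℝ) :
    0 < Real.sin x ^ 2 + β * Real.cos x ^ 2 := by
  rcases eq_or_ne (Real.cos x) 0 with h | h
  · have := Real.sin_sq_add_cos_sq x
    rw [h] at this ⊢
    linarith
  · positivity

variable {l} in
-- `sin (2θ) = 0` kills the singular term, leaving a positive one. The angle need not increase
-- elsewhere.
theorem angularSpeed_pos (hpos : ∀ r ∈ Icc (0 : ℝ) 1, 0 < b r) (hl : 0 < l) {r : ℝ}
    (hr : r ∈ Icc (0 : ℝ) 1) (hc : Real.sin (2 * pruferAngle n hb l r) = 0) :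
    0 < angularSpeed n hb l r := by
  rcases hr.1.eq_or_lt with rfl | h0
  · rw [angularSpeed_zero]
    have := hpos 0 hr
    positivity
  · rw [angularSpeed_eq n hb l ⟨h0, hr.2⟩]
    rw [Real.sin_two_mul, mul_assoc] at hc
    rw [(mul_eq_zero.1 hc).resolve_left two_ne_zero, mul_zero, sub_zero]
    exact mul_pos hl (sin_sq_add_mul_cos_sq_pos (hpos r hr) _)

variable {l} in
theorem lt_pruferAngle (hpos : ∀ r ∈ Icc (0 : ℝ) 1, 0 < b r) (hl : 0 < l) {c : ℝ}
    (hc : Real.sin (2 * c) = 0) {r s : ℝ} (hr : 0 ≤ r) (hrs : r < s) (hs : s ≤ 1)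
    (h : c ≤ pruferAngle n hb l r) : c < pruferAngle n hb l s := by
  have hsub : Icc r s ⊆ Icc 0 1 := Icc_subset_Icc hr hs
  refine lt_of_deriv_pos_at_level (fun x hx => hasDerivAt_pruferAngle n hb l (hsub hx))
    (fun x hx hxc => angularSpeed_pos n hb hpos hl (hsub hx) (by rw [hxc, hc])) h ⟨hrs, le_rfl⟩

/-- Where the two angles agree the singular terms cancel, and the speeds differ by `(l₂ - l₁)(sin² θ
+ b cos² θ) > 0`. Hence the difference, starting at `0`, becomes and stays positive. The point `r =
0` needs the limiting value of the speed. -/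
theorem pruferAngle_lt_pruferAngle (hpos : ∀ r ∈ Icc (0 : ℝ) 1, 0 < b r) {l₁ l₂ : ℝ}
    (hl : l₁ < l₂) {r : ℝ} (hr : r ∈ Ioc (0 : ℝ) 1) :
    pruferAngle n hb l₁ r < pruferAngle n hb l₂ r := by
  have h := lt_of_deriv_pos_at_level (c := 0) (a := 0) (b := 1)
    (f := fun x => pruferAngle n hb l₂ x - pruferAngle n hb l₁ x)
    (fun x hx => (hasDerivAt_pruferAngle n hb l₂ hx).sub (hasDerivAt_pruferAngle n hb l₁ hx))
    (fun x hx hx0 => ?_) (by simp [pruferAngle_zero]) hr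
  · exact sub_pos.1 h
  · rcases hx.1.eq_or_lt with rfl | h0
    · rw [angularSpeed_zero, angularSpeed_zero, ← sub_div, ← sub_mul]
      have := hpos 0 hx
      have := sub_pos.2 hl
      positivity
    · rw [angularSpeed_eq n hb _ ⟨h0, hx.2⟩, angularSpeed_eq n hb _ ⟨h0, hx.2⟩,
        sub_eq_zero.1 hx0]
      have := mul_pos (sub_pos.2 hl)
        (sin_sq_add_mul_cos_sq_pos (hpos x hx) (pruferAngle n hb l₁ x))
      linarith

theorem strictMono_pruferAngle_one (hpos : ∀ r ∈ Icc (0 : ℝ) 1, 0 < b r) :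
    StrictMono fun l => pruferAngle n hb l 1 :=
  fun _ _ h => pruferAngle_lt_pruferAngle n hb hpos h (by simp)

variable {l} in
theorem pruferAngle_nonneg (hpos : ∀ r ∈ Icc (0 : ℝ) 1, 0 < b r) (hl : 0 ≤ l) {r : ℝ}
    (hr : r ∈ Icc (0 : ℝ) 1) : 0 ≤ pruferAngle n hb l r := by
  rcases hr.1.eq_or_lt with rfl | h0
  · rw [pruferAngle_zero]
  rcases hl.eq_or_lt with rfl | hl
  · rw [pruferAngle_param_zero]
  · have := pruferAngle_lt_pruferAngle n hb hpos hl ⟨h0, hr.2⟩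
    rw [pruferAngle_param_zero] at this
    exact this.le

/-- Away from the origin the singular term is bounded: on `[1/2, 1]` it is at most `2n · 1/2 = n`. A
speed of at least `l α - n ≥ 2K` over length `1/2` gains `K` on an angle that is nonnegative at
`1/2`. -/
theorem exists_le_pruferAngle_one (hpos : ∀ r ∈ Icc (0 : ℝ) 1, 0 < b r) (K : ℝ) :
    ∃ l, K ≤ pruferAngle n hb l 1 := by
  obtain ⟨x₀, hx₀, hmin⟩ := isCompact_Icc.exists_isMinOn (nonempty_Icc.2 (zero_le_one' ℝ))
    hb.continuousOn
  -- With `α` below both `1` and `b`, `sin² + b cos² ≥ α`.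
  set α := min 1 (b x₀) with hα
  have hα0 : 0 < α := lt_min one_pos (hpos x₀ hx₀)
  set l := max 0 ((2 * K + n) / α) with hl
  have hl0 : 0 ≤ l := le_max_left _ _
  have hlα : 2 * K + n ≤ l * α := (div_le_iff₀ hα0).1 (le_max_right _ _)
  refine ⟨l, ?_⟩
  have hsub : Icc (1 / 2 : ℝ) 1 ⊆ Icc 0 1 := Icc_subset_Icc_left (by norm_num)
  have h := (convex_Icc (1 / 2 : ℝ) 1).mul_sub_le_image_sub_of_le_deriv
    ((continuousOn_pruferAngle n hb l).mono hsub)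
    (fun x hx => (hasDerivAt_pruferAngle n hb l
      (hsub (interior_subset hx))).differentiableAt.differentiableWithinAt)
    (C := 2 * K) (fun x hx => ?_) (1 / 2) (by norm_num) 1 (by norm_num) (by norm_num)
  · have := pruferAngle_nonneg n hb hpos hl0 (r := 1 / 2) (by norm_num)
    linarith
  · have hx' := interior_subset hx
    have hx0 : 0 < x := by linarith [hx'.1]
    rw [(hasDerivAt_pruferAngle n hb l (hsub hx')).deriv,
      angularSpeed_eq n hb l ⟨hx0, hx'.2⟩]
    set s := Real.sin (pruferAngle n hb l x)
    set c := Real.cos (pruferAngle n hb l x)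
    have hsc : s ^ 2 + c ^ 2 = 1 := Real.sin_sq_add_cos_sq _
    have hbx : α ≤ b x := (min_le_right _ _).trans (hmin (hsub hx'))
    have h1 : α ≤ s ^ 2 + b x * c ^ 2 := by
      have e1 : α * s ^ 2 ≤ 1 * s ^ 2 := by gcongr; exact min_le_left _ _
      have e2 : α * c ^ 2 ≤ b x * c ^ 2 := by gcongr
      nlinarith
    have h2 : n / x * (s * c) ≤ n := by
      have e1 : s * c ≤ 1 / 2 := by nlinarith [sq_nonneg (s - c)]
      have e2 : (n : ℝ) / x ≤ 2 * n := by
        rw [div_le_iff₀ hx0]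
        have : (0 : ℝ) ≤ n := n.cast_nonneg
        nlinarith [hx'.1]
      have e3 : (0 : ℝ) ≤ n / x := by positivity
      nlinarith
    have h3 : l * α ≤ l * (s ^ 2 + b x * c ^ 2) := by gcongr
    linarith

/-- The nonnegative parameters `l` for which the Prüfer angle at `1` is a multiple of `π`. -/
theorem exists_eigenparameters (hpos : ∀ r ∈ Icc (0 : ℝ) 1, 0 < b r) :
    ∃ L : ℕ → ℝ, (∀ k, pruferAngle n hb (L k) 1 = k * Real.pi) ∧ L 0 = 0 ∧ StrictMono L ∧
      Tendsto L atTop atTop := by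
  have hmono := strictMono_pruferAngle_one n hb hpos
  have hex : ∀ k : ℕ, ∃ l, pruferAngle n hb l 1 = k * Real.pi := fun k =>
    mem_range_of_exists_le_of_exists_ge (continuous_pruferAngle_param n hb 1)
      ⟨0, by rw [pruferAngle_param_zero]; positivity⟩ (exists_le_pruferAngle_one n hb hpos _)
  choose L hL using hex
  refine ⟨L, hL, ?_, ?_, ?_⟩
  · refine hmono.injective ?_
    simp [hL, pruferAngle_param_zero]
  · intro i j hij
    rw [← hmono.lt_iff_lt]
    simp only [hL]
    have := Real.pi_pos
    gcongr
  · rw [tendsto_atTop]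
    intro K
    have ht : Tendsto (fun k : ℕ => (k : ℝ) * Real.pi) atTop atTop :=
      tendsto_natCast_atTop_atTop.atTop_mul_const Real.pi_pos
    filter_upwards [ht.eventually_ge_atTop (pruferAngle n hb K 1)] with k hk
    rw [← hL] at hk
    exact hmono.le_iff_le.1 hk

/-- The angle runs from `0` to `kπ` and meets each level `(j + 1/2)π` with `j < k`, only once
because crossings are upward. -/
theorem encard_zeros_pruferU (hpos : ∀ r ∈ Icc (0 : ℝ) 1, 0 < b r) (hl : 0 < l) {k : ℕ}
    (hk : pruferAngle n hb l 1 = k * Real.pi) :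
    {r ∈ Icc (0 : ℝ) 1 | pruferU n hb l r = 0}.encard = k := by
  have hπ := Real.pi_pos
  have hsin : ∀ j : ℕ, Real.sin (2 * ((2 * j + 1) * Real.pi / 2)) = 0 := fun j => by
    rw [mul_div_cancel₀ _ two_ne_zero]
    exact_mod_cast Real.sin_nat_mul_pi (2 * j + 1)
  have hex : ∀ j : ℕ, j < k → ∃ z ∈ Icc (0 : ℝ) 1,
      pruferAngle n hb l z = (2 * j + 1) * Real.pi / 2 := fun j hj => by
    have h := intermediate_value_Icc zero_le_one (continuousOn_pruferAngle n hb l)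
    rw [pruferAngle_zero, hk] at h
    have hj' : (j : ℝ) + 1 ≤ k := by exact_mod_cast hj
    exact h ⟨by positivity, by nlinarith⟩
  choose! z hz hzθ using hex
  have hset : {r ∈ Icc (0 : ℝ) 1 | pruferU n hb l r = 0} = z '' Iio k := by
    ext r
    constructor
    · rintro ⟨hr, hr0⟩
      rw [pruferU_eq_zero_iff n hb l hr, Real.cos_eq_zero_iff] at hr0
      obtain ⟨i, hi⟩ := hr0
      have h0 := pruferAngle_nonneg n hb hpos hl.le hr
      -- Once at or above `kπ` before `r = 1`, the angle would end strictly above `kπ`.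
      have h1 : pruferAngle n hb l r ≤ k * Real.pi := by
        by_contra! hlt
        have hr1 : r < 1 := hr.2.lt_of_ne fun h => by rw [h, hk] at hlt; exact lt_irrefl _ hlt
        have := lt_pruferAngle n hb hpos hl (c := k * Real.pi)
          (by rw [← mul_assoc]; exact_mod_cast Real.sin_nat_mul_pi (2 * k))
          hr.1 hr1 le_rfl hlt.le
        rw [hk] at this
        exact lt_irrefl _ this
      rw [hi] at h0 h1
      have hi0 : (-1 : ℝ) < i := by nlinarith
      have hik : (i : ℝ) < k := by nlinarith
      have hi0' : 0 ≤ i := by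
        have : (-1 : ℤ) < i := by exact_mod_cast hi0
        omega
      lift i to ℕ using hi0'
      have hik' : i < k := by exact_mod_cast hik
      refine ⟨i, hik', ?_⟩
      have e : pruferAngle n hb l r = (2 * (i : ℝ) + 1) * Real.pi / 2 := by exact_mod_cast hi
      have e' := hzθ i hik'
      rcases lt_trichotomy (z i) r with h | h | h
      · exact absurd (lt_pruferAngle n hb hpos hl (hsin i) (hz i hik').1 h hr.2 e'.ge) e.not_gt
      · exact h
      · exact absurd (lt_pruferAngle n hb hpos hl (hsin i) hr.1 h (hz i hik').2 e.ge) e'.not_gt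
    · rintro ⟨j, hj, rfl⟩
      refine ⟨hz j hj, ?_⟩
      rw [pruferU_eq_zero_iff n hb l (hz j hj), Real.cos_eq_zero_iff]
      exact ⟨j, by rw [hzθ j hj]; push_cast; ring⟩
  have hinj : InjOn z (Iio k) := fun i hi j hj hij => by
    have h := hzθ i hi
    rw [hij, hzθ j hj] at h
    have h2 : (j : ℝ) = i := by nlinarith
    exact_mod_cast h2.symm
  rw [hset, hinj.encard_image, ← Finset.coe_range, encard_coe_eq_coe_finsetCard,
    Finset.card_range]

/-- The levels `0` and `π` are crossed only upwards, so the angle lies strictly between them inside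
the interval. This yields monotonicity for `k = 1`. -/
theorem pruferY_ne_zero (hpos : ∀ r ∈ Icc (0 : ℝ) 1, 0 < b r) (hl : 0 < l)
    (hk : pruferAngle n hb l 1 = Real.pi) {r : ℝ} (hr : r ∈ Ioo (0 : ℝ) 1) :
    pruferY n hb l r ≠ 0 := by
  rw [Ne, pruferY_eq_zero_iff n hb l ⟨hr.1.le, hr.2.le⟩]
  refine (Real.sin_pos_of_pos_of_lt_pi ?_ ?_).ne'
  · exact lt_pruferAngle n hb hpos hl (by simp) le_rfl hr.1 hr.2.le (pruferAngle_zero n hb l).ge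
  · by_contra! h
    exact absurd hk (lt_pruferAngle n hb hpos hl (by simp) hr.1.le hr.2 le_rfl h).ne'

/-- Multiply the equation by `u` and integrate: `F` equals `-xⁿ u u'/m` and would vanish at both
ends, while for `m < 0` its derivative is a sum of nonnegative terms. So `F` would be constant,
although `xⁿ b u² > 0` near `0`. -/
theorem sourceMean_one_ne_zero_of_neg (hpos : ∀ r ∈ Icc (0 : ℝ) 1, 0 < b r) {m : ℝ} (hm : m < 0) :
    sourceMean n hb m 1 ≠ 0 := by
  intro h1
  set u := radialSolution n hb m
  set g := sourceMean n hb m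
  have hP : ∀ x, HasDerivAt (fun x => x ^ (n + 1) * g x) (x ^ n * source n hb m x) x := fun x => by
    have hc := continuous_source n hb m
    refine (intervalIntegral.integral_hasDerivAt_right (f := fun x => x ^ n * source n hb m x)
        (a := 0) (Continuous.intervalIntegrable (by fun_prop) _ _)
        (Continuous.stronglyMeasurableAtFilter (by fun_prop) _ _)
        (by fun_prop)).congr_of_eventuallyEq (Eventually.of_forall fun y => ?_)
    exact pow_mul_radialMean n _ y
  set F : ℝ → ℝ := fun x => u x * (x ^ (n + 1) * g x)
  have hF : ∀ x, HasDerivAt F (-m * (x * g x) * (x ^ (n + 1) * g x) +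
      u x * (x ^ n * source n hb m x)) x :=
    fun x => (hasDerivAt_radialSolution n hb m x).mul (hP x)
  have hFd : ∀ x ∈ Icc (0 : ℝ) 1, deriv F x = -m * x ^ (n + 2) * g x ^ 2 + x ^ n * b x * u x ^ 2 :=
    fun x hx => by
    rw [(hF x).deriv, source_eq n hb m hx]
    ring
  have hmono : MonotoneOn F (Icc 0 1) := by
    refine monotoneOn_of_deriv_nonneg (convex_Icc 0 1)
      (fun x _ => (hF x).continuousAt.continuousWithinAt)
      (fun x _ => (hF x).differentiableAt.differentiableWithinAt) fun x hx => ?_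
    have hx' := interior_subset hx
    rw [hFd x hx']
    have := hpos x hx'
    have := hx'.1
    have : 0 < -m := by linarith
    positivity
  have hF0 : ∀ x ∈ Icc (0 : ℝ) 1, F x = 0 := fun x hx => by
    have e0 : F 0 = 0 := by simp [F]
    have e1 : F 1 = 0 := by simp [F, h1]
    have := hmono (by simp) hx hx.1
    have := hmono hx (by simp) hx.2
    linarith
  have hev : ∀ᶠ x in 𝓝 (0 : ℝ), 0 < u x :=
    (continuous_radialSolution n hb m).continuousAt.eventually
      (lt_mem_nhds (by rw [radialSolution_zero]; exact one_pos))
  obtain ⟨x, hux, hx⟩ := ((hev.filter_mono nhdsWithin_le_nhds).and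
    (Ioo_mem_nhdsGT one_pos)).exists
  have hx' : x ∈ Icc (0 : ℝ) 1 := ⟨hx.1.le, hx.2.le⟩
  have hd0 : deriv F x = 0 := by
    have : F =ᶠ[𝓝 x] fun _ => 0 := by
      filter_upwards [Icc_mem_nhds hx.1 hx.2] with y hy using hF0 y hy
    rw [this.deriv_eq, deriv_const]
  rw [hFd x hx'] at hd0
  have h3 := hpos x hx'
  have h4 := hx.1
  have h5 : 0 < -m := by linarith
  have h6 : 0 ≤ -m * x ^ (n + 2) * g x ^ 2 := by positivity
  have h7 : 0 < x ^ n * b x * u x ^ 2 := by positivity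
  linarith

theorem exists_eigenparameter_of_mul_sourceMean_eq_zero (hpos : ∀ r ∈ Icc (0 : ℝ) 1, 0 < b r)
    {m : ℝ} (h : m * sourceMean n hb m 1 = 0) :
    ∃ (l : ℝ) (k : ℕ), m = l ^ 2 ∧ pruferAngle n hb l 1 = k * Real.pi := by
  rcases lt_or_ge m 0 with hm | hm
  · exact absurd ((mul_eq_zero.1 h).resolve_left hm.ne) (sourceMean_one_ne_zero_of_neg n hb hpos hm)
  refine ⟨√m, ?_⟩
  have hm2 : √m ^ 2 = m := Real.sq_sqrt hm
  rcases hm.eq_or_lt with rfl | hm0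
  · exact ⟨0, by simp [pruferAngle_param_zero]⟩
  have hY : pruferY n hb (√m) 1 = 0 := by
    rw [pruferY, hm2, (mul_eq_zero.1 h).resolve_left hm0.ne']
    simp
  rw [pruferY_eq_zero_iff n hb _ (by simp), Real.sin_eq_zero_iff] at hY
  obtain ⟨i, hi⟩ := hY
  have h0 := pruferAngle_nonneg n hb hpos (Real.sqrt_nonneg m) (r := 1) (by simp)
  have hi0 : 0 ≤ i := by
    rw [← hi] at h0
    exact_mod_cast nonneg_of_mul_nonneg_left h0 Real.pi_pos
  lift i to ℕ using hi0
  exact ⟨i, hm2.symm, by exact_mod_cast hi.symm⟩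

theorem mul_sourceMean_eq_zero {k : ℕ} (hk : pruferAngle n hb l 1 = k * Real.pi) :
    l ^ 2 * sourceMean n hb (l ^ 2) 1 = 0 := by
  have hY : pruferY n hb l 1 = 0 := by
    rw [pruferY_eq_zero_iff n hb _ (by simp), hk, Real.sin_nat_mul_pi]
  rw [pruferY, one_mul] at hY
  rw [pow_two, mul_assoc, ← pow_two, hY, mul_zero]

end

/-! ### From the Prüfer angle to eigenfunctions on the interval -/

section

/-- Monotonicity would force `u` to vanish on the whole segment between two zeros, but the zero set
is finite. -/
theorem le_one_of_isMonotoneOnUnitInterval {u : ℝ → ℝ} {k : ℕ}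
    (h : HasExactlySimpleZeros u k) (hu : IsMonotoneOnUnitInterval u) : k ≤ 1 := by
  by_contra! hk
  have h1 : 1 < {r ∈ Icc (0 : ℝ) 1 | u r = 0}.encard := by
    rw [h.1]
    exact_mod_cast hk
  obtain ⟨x, y, hx, hy, hxy⟩ := one_lt_encard_iff.1 h1
  wlog hlt : x < y generalizing x y
  · exact this y x hy hx hxy.symm (lt_of_le_of_ne (not_lt.1 hlt) hxy.symm)
  have hsub : Icc x y ⊆ {r ∈ Icc (0 : ℝ) 1 | u r = 0} := fun z hz => by
    have hz' : z ∈ Icc (0 : ℝ) 1 := ⟨hx.1.1.trans hz.1, hz.2.trans hy.1.2⟩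
    have ex := hx.2
    have ey := hy.2
    refine ⟨hz', ?_⟩
    rcases hu with hu | hu
    · have := hu hx.1 hz' hz.1
      have := hu hz' hy.1 hz.2
      linarith
    · have := hu hx.1 hz' hz.1
      have := hu hz' hy.1 hz.2
      linarith
  have hfin : {r ∈ Icc (0 : ℝ) 1 | u r = 0}.Finite := finite_of_encard_eq_coe h.1
  exact Icc_infinite hlt (hfin.subset hsub)

variable (n : ℕ) {b : ℝ → ℝ} (hb : Continuous b)

/-- Zeros and monotonicity of the multiples of the solution for the `k`-th eigenvalue. -/
theorem zeros_and_monotonicity (hpos : ∀ r ∈ Icc (0 : ℝ) 1, 0 < b r) {l : ℝ} {k : ℕ}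
    (hk : pruferAngle n hb l 1 = k * Real.pi) {c : ℝ} (hc : c ≠ 0) {ψ : ℝ → ℝ}
    (hψ : EqOn ψ (fun r => c * pruferU n hb l r) (Icc 0 1)) :
    HasExactlySimpleZeros ψ k ∧ (IsMonotoneOnUnitInterval ψ ↔ k = 0 ∨ k = 1) := by
  have hmono := strictMono_pruferAngle_one n hb hpos
  rcases Nat.eq_zero_or_pos k with rfl | hk0
  · have hl : l = 0 := hmono.injective (by simpa [pruferAngle_param_zero] using hk)
    subst hl
    have hψ1 : ∀ r ∈ Icc (0 : ℝ) 1, ψ r = c := fun r hr => by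
      rw [hψ hr]
      simp [pruferU, radialSolution_param_zero]
    refine ⟨⟨?_, fun r hr h0 => absurd ((hψ1 r hr).symm.trans h0) hc⟩, ?_⟩
    · rw [Nat.cast_zero, encard_eq_zero, eq_empty_iff_forall_notMem]
      exact fun r hr => hc ((hψ1 r hr.1).symm.trans hr.2)
    · refine iff_of_true (Or.inl fun x hx y hy _ => ?_) (Or.inl rfl)
      rw [hψ1 x hx, hψ1 y hy]
  have hl : 0 < l := by
    rw [← hmono.lt_iff_lt]
    simp only [pruferAngle_param_zero, hk]
    have := Real.pi_pos
    positivity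
  have hd : ∀ r ∈ Icc (0 : ℝ) 1,
      HasDerivWithinAt ψ (c * (-l * pruferY n hb l r)) (Icc 0 1) r := fun r hr =>
    ((hasDerivAt_pruferU n hb l r).const_mul c).hasDerivWithinAt.congr hψ (hψ hr)
  have hz : ∀ r ∈ Icc (0 : ℝ) 1, (ψ r = 0 ↔ pruferU n hb l r = 0) := fun r hr => by
    rw [hψ hr]
    simp [hc]
  have hzeros : HasExactlySimpleZeros ψ k := by
    refine ⟨?_, fun r hr h0 => ?_⟩
    · rw [← encard_zeros_pruferU n hb l hpos hl hk]
      congr 1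
      ext r
      exact and_congr_right fun hr => hz r hr
    · rw [(hd r hr).derivWithin (uniqueDiffOn_Icc zero_lt_one r hr)]
      have hU := (hz r hr).1 h0
      have hE := pruferE_pos n hb l hr
      have hY : pruferY n hb l r ≠ 0 := fun hY => by simp [pruferE, hU, hY] at hE
      exact mul_ne_zero hc (mul_ne_zero (neg_ne_zero.2 hl.ne') hY)
  refine ⟨hzeros, fun h => ?_, ?_⟩
  · have := le_one_of_isMonotoneOnUnitInterval hzeros h
    omega
  · rintro (rfl | rfl)
    · exact absurd hk0 (lt_irrefl 0)
    rw [Nat.cast_one, one_mul] at hk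
    have hcd : ∀ r, HasDerivAt (fun r => c * pruferU n hb l r) (c * (-l * pruferY n hb l r)) r :=
      fun r => (hasDerivAt_pruferU n hb l r).const_mul c
    have hcont : ContinuousOn (fun r => c * pruferU n hb l r) (Icc 0 1) :=
      fun r _ => (hcd r).continuousAt.continuousWithinAt
    have hne : ∀ r ∈ Ioo (0 : ℝ) 1, c * (-l * pruferY n hb l r) ≠ 0 := fun r hr =>
      mul_ne_zero hc (mul_ne_zero (neg_ne_zero.2 hl.ne') (pruferY_ne_zero n hb l hpos hl hk hr))
    -- By Darboux, a derivative without zeros on an interval has constant sign.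
    rcases hasDerivWithinAt_forall_lt_or_forall_gt_of_forall_ne (convex_Ioo (0 : ℝ) 1)
      (fun r _ => (hcd r).hasDerivWithinAt) hne with h | h
    · refine Or.inr (AntitoneOn.congr ?_ hψ.symm)
      refine antitoneOn_of_deriv_nonpos (convex_Icc 0 1) hcont
        (fun r _ => (hcd r).differentiableAt.differentiableWithinAt) fun r hr => ?_
      rw [interior_Icc] at hr
      rw [(hcd r).deriv]
      exact (h r hr).le
    · refine Or.inl (MonotoneOn.congr ?_ hψ.symm)
      refine monotoneOn_of_deriv_nonneg (convex_Icc 0 1) hcont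
        (fun r _ => (hcd r).differentiableAt.differentiableWithinAt) fun r hr => ?_
      rw [interior_Icc] at hr
      rw [(hcd r).deriv]
      exact (h r hr).le

variable {n} {m : ℝ} {u : ℝ → ℝ}

theorem eqOn_of_isNeumannEigenfunction (hu : IsNeumannEigenfunction (n + 1) b m u) :
    u 0 ≠ 0 ∧ EqOn u (fun r => u 0 * radialSolution n hb m r) (Icc 0 1) ∧
      m * sourceMean n hb m 1 = 0 := by
  obtain ⟨hs, r₀, hr₀, hne⟩ := hu
  have heq : EqOn u (fun r => u 0 * radialSolution n hb m r) (Icc 0 1) := fun r hr =>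
    eq_mul_radialSolution hb hs.contDiffOn hs.equation hs.neumann_zero hr
  have h0 : u 0 ≠ 0 := fun h0 => hne (by simp [heq hr₀, h0])
  refine ⟨h0, heq, ?_⟩
  have h1 : (1 : ℝ) ∈ Icc (0 : ℝ) 1 := by simp
  have hd := (((hasDerivAt_radialSolution n hb m 1).const_mul (u 0)).hasDerivWithinAt.congr heq
    (heq h1)).derivWithin (uniqueDiffOn_Icc zero_lt_one 1 h1)
  rw [hs.neumann_one] at hd
  have := (mul_eq_zero.1 hd.symm).resolve_left h0
  linarith

theorem isNeumannEigenfunction_radialSolution (h : m * sourceMean n hb m 1 = 0) :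
    IsNeumannEigenfunction (n + 1) b m (radialSolution n hb m) :=
  ⟨isNeumannSolution_radialSolution n hb m h, 0, by simp, by simp [radialSolution_zero]⟩

theorem exists_eq_mul_of_isNeumannEigenfunction (hb : Continuous b) {v : ℝ → ℝ}
    (hu : IsNeumannEigenfunction (n + 1) b m u) (hv : IsNeumannEigenfunction (n + 1) b m v) :
    ∃ c : ℝ, ∀ r ∈ Icc (0 : ℝ) 1, v r = c * u r := by
  obtain ⟨hu0, hue, -⟩ := eqOn_of_isNeumannEigenfunction hb hu
  obtain ⟨-, hve, -⟩ := eqOn_of_isNeumannEigenfunction hb hv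
  refine ⟨v 0 / u 0, fun r hr => ?_⟩
  rw [hue hr, hve hr]
  field_simp

end

/-! ### Radial functions in the ball -/

section

section InnerProductSpace

variable {F : Type*} [NormedAddCommGroup F] [InnerProductSpace ℝ F]

theorem hasFDerivAt_norm_of_ne_zero {x : F} (hx : x ≠ 0) :
    HasFDerivAt (fun y : F => ‖y‖) (‖x‖⁻¹ • innerSL ℝ x) x := by
  have h := (hasStrictFDerivAt_norm_sq x).hasFDerivAt.sqrt (pow_ne_zero 2 (norm_ne_zero_iff.2 hx))
  simp only [Real.sqrt_sq (norm_nonneg _)] at h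
  refine h.congr_fderiv ?_
  ext y
  simp
  ring

/-- The orthogonal projection to the line spanned by `x`. -/
noncomputable def lineProj (x : F) : F →L[ℝ] F := (‖x‖ ^ 2)⁻¹ • (innerSL ℝ x).smulRight x

theorem lineProj_apply (x y : F) : lineProj x y = ((‖x‖ ^ 2)⁻¹ * inner ℝ x y) • x := by
  simp [lineProj, smul_smul]

theorem norm_lineProj_le (x : F) : ‖lineProj x‖ ≤ 1 := by
  refine ContinuousLinearMap.opNorm_le_bound _ zero_le_one fun y => ?_
  rcases eq_or_ne x 0 with rfl | hx
  · simp [lineProj_apply]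
  have hx' := norm_pos_iff.2 hx
  rw [lineProj_apply, norm_smul, norm_mul, norm_inv, norm_pow, norm_norm, one_mul]
  have := norm_inner_le_norm (𝕜 := ℝ) x y
  calc (‖x‖ ^ 2)⁻¹ * ‖inner ℝ x y‖ * ‖x‖ ≤ (‖x‖ ^ 2)⁻¹ * (‖x‖ * ‖y‖) * ‖x‖ := by gcongr
    _ = ‖y‖ := by field_simp

theorem continuousAt_lineProj {x : F} (hx : x ≠ 0) : ContinuousAt (lineProj (F := F)) x := by
  unfold lineProj
  have h : Continuous fun x : F => (innerSL ℝ x).smulRight x := by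
    have : Continuous fun p : F × F => ContinuousLinearMap.smulRightL ℝ F F (innerSL ℝ p.1) p.2 := by
      fun_prop
    exact this.comp (by fun_prop : Continuous fun x : F => (x, x))
  exact ContinuousAt.smul (ContinuousAt.inv₀ (continuous_norm.pow 2).continuousAt
    (pow_ne_zero 2 (norm_ne_zero_iff.2 hx))) h.continuousAt

/-- The trace of a rank-one orthogonal projection is `1`. -/
theorem sum_inner_lineProj {ι : Type*} [Fintype ι] (v : OrthonormalBasis ι ℝ F) {x : F}
    (hx : x ≠ 0) : ∑ i, inner ℝ (lineProj x (v i)) (v i) = 1 := by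
  have hx' := norm_ne_zero_iff.2 hx
  have h := v.sum_sq_norm_inner_left x
  simp only [lineProj_apply, real_inner_smul_left, mul_assoc, ← pow_two]
  rw [← Finset.mul_sum, inv_mul_eq_one₀ (pow_ne_zero 2 hx'), ← h]
  simp

theorem hasFDerivAt_comp_norm {f : ℝ → ℝ} {f' : ℝ} {x : F} (hx : x ≠ 0)
    (hf : HasDerivAt f f' ‖x‖) :
    HasFDerivAt (fun y : F => f ‖y‖) (innerSL ℝ ((f' / ‖x‖) • x)) x := by
  refine (hf.comp_hasFDerivAt x (hasFDerivAt_norm_of_ne_zero hx)).congr_fderiv ?_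
  rw [map_smul, smul_smul, div_eq_mul_inv]

theorem hasFDerivAt_norm_smul {G : ℝ → ℝ} {G' : ℝ} {x : F} (hx : x ≠ 0)
    (hG : HasDerivAt G G' ‖x‖) :
    HasFDerivAt (fun y : F => G ‖y‖ • y)
      (G ‖x‖ • ContinuousLinearMap.id ℝ F + (G' * ‖x‖) • lineProj x) x := by
  refine ((hasFDerivAt_comp_norm hx hG).smul (hasFDerivAt_id x)).congr_fderiv ?_
  ext y
  have hx' := norm_ne_zero_iff.2 hx
  simp only [lineProj_apply, _root_.add_apply, _root_.smul_apply, ContinuousLinearMap.id_apply,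
    ContinuousLinearMap.smulRight_apply, innerSL_apply_apply, real_inner_smul_left, smul_smul, id]
  congr 2
  field_simp

/-- The Laplacian is the divergence of the gradient. -/
theorem laplacian_eq_sum_inner [FiniteDimensional ℝ F] {ι : Type*} [Fintype ι]
    (v : OrthonormalBasis ι ℝ F) {U : F → ℝ} {V : F → F} {D : F →L[ℝ] F} {x : F}
    (hU : ∀ᶠ y in 𝓝 x, HasFDerivAt U (innerSL ℝ (V y)) y) (hV : HasFDerivAt V D x) :
    Δ U x = ∑ i, inner ℝ (D (v i)) (v i) := by
  have h1 : fderiv ℝ U =ᶠ[𝓝 x] fun y => innerSL ℝ (V y) := hU.mono fun y hy => hy.fderiv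
  have h2 : HasFDerivAt (fun y => innerSL ℝ (V y)) ((innerSL ℝ).comp D) x :=
    (innerSL ℝ : F →L[ℝ] F →L[ℝ] ℝ).hasFDerivAt.comp x hV
  rw [congrFun (InnerProductSpace.laplacian_eq_iteratedFDeriv_orthonormalBasis U v) x]
  refine Finset.sum_congr rfl fun i _ => ?_
  rw [iteratedFDeriv_two_apply, h1.fderiv_eq, h2.fderiv]
  simp

end InnerProductSpace

variable {n : ℕ}

theorem sum_inner_smul_id_add (x : EuclideanSpace ℝ (Fin (n + 1))) (hx : x ≠ 0) (α β : ℝ) :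
    ∑ i, inner ℝ ((α • ContinuousLinearMap.id ℝ (EuclideanSpace ℝ (Fin (n + 1))) +
      β • lineProj x) (EuclideanSpace.basisFun (Fin (n + 1)) ℝ i))
      (EuclideanSpace.basisFun (Fin (n + 1)) ℝ i) = (n + 1) * α + β := by
  simp only [_root_.add_apply, _root_.smul_apply, ContinuousLinearMap.id_apply, inner_add_left,
    real_inner_smul_left]
  rw [Finset.sum_add_distrib, ← Finset.mul_sum, ← Finset.mul_sum, sum_inner_lineProj _ hx]
  simp
  ring

variable (n) {b : ℝ → ℝ} (hb : Continuous b) (m : ℝ)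

theorem hasDerivAt_sourceMean {r : ℝ} (hr : r ≠ 0) : HasDerivAt (sourceMean n hb m)
    ((source n hb m r - (n + 1) * sourceMean n hb m r) / r) r := by
  refine (((hasDerivAt_mul_sourceMean n hb m r).div (hasDerivAt_id r) hr).congr_of_eventuallyEq
    ?_).congr_deriv ?_
  · filter_upwards [isOpen_ne.mem_nhds hr] with x hx
    have hx : x ≠ 0 := hx
    simp [hx]
  · simp only [id]
    field_simp
    ring

/-- The radial function on `ℝⁿ⁺¹` with profile `radialSolution`. -/
noncomputable def ballSolution (x : EuclideanSpace ℝ (Fin (n + 1))) : ℝ :=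
  radialSolution n hb m ‖x‖

/-- The gradient of `ballSolution`. -/
noncomputable def ballGradient (x : EuclideanSpace ℝ (Fin (n + 1))) :
    EuclideanSpace ℝ (Fin (n + 1)) :=
  (-m * sourceMean n hb m ‖x‖) • x

/-- The Hessian of `ballSolution`. -/
noncomputable def ballHessian (x : EuclideanSpace ℝ (Fin (n + 1))) :
    EuclideanSpace ℝ (Fin (n + 1)) →L[ℝ] EuclideanSpace ℝ (Fin (n + 1)) :=
  (-m * sourceMean n hb m ‖x‖) • ContinuousLinearMap.id ℝ _ +
    (-m * (source n hb m ‖x‖ - (n + 1) * sourceMean n hb m ‖x‖)) • lineProj x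

/-- This is the coefficient of `lineProj` in the Hessian. Its vanishing at the centre is what makes
`ballSolution` of class `C²` there. -/
theorem source_zero_sub : source n hb m 0 - (n + 1) * sourceMean n hb m 0 = 0 := by
  rw [sourceMean, radialMean_zero]
  field_simp
  ring

theorem hasFDerivAt_ballSolution (x : EuclideanSpace ℝ (Fin (n + 1))) :
    HasFDerivAt (ballSolution n hb m) (innerSL ℝ (ballGradient n hb m x)) x := by
  rcases eq_or_ne x 0 with rfl | hx
  · have h := hasDerivAt_radialSolution n hb m 0
    rw [zero_mul, mul_zero, hasDerivAt_iff_isLittleO_nhds_zero] at h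
    rw [ballGradient, smul_zero, map_zero, hasFDerivAt_iff_isLittleO_nhds_zero]
    have ht : Tendsto (fun x : EuclideanSpace ℝ (Fin (n + 1)) => ‖x‖) (𝓝 0) (𝓝 0) := by
      simpa using (continuous_norm (E := EuclideanSpace ℝ (Fin (n + 1)))).tendsto 0
    have h2 := h.comp_tendsto ht
    refine Asymptotics.isLittleO_norm_right.1 ?_
    simpa only [Function.comp_def, ballSolution, norm_zero, zero_add, smul_zero, sub_zero,
      zero_apply] using h2
  · refine (hasFDerivAt_comp_norm hx (hasDerivAt_radialSolution n hb m ‖x‖)).congr_fderiv ?_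
    have hx' := norm_ne_zero_iff.2 hx
    rw [ballGradient]
    congr 2
    field_simp

theorem hasFDerivAt_ballGradient (x : EuclideanSpace ℝ (Fin (n + 1))) :
    HasFDerivAt (ballGradient n hb m) (ballHessian n hb m x) x := by
  rcases eq_or_ne x 0 with rfl | hx
  · rw [hasFDerivAt_iff_isLittleO_nhds_zero]
    have ht : Tendsto (fun x : EuclideanSpace ℝ (Fin (n + 1)) =>
        -m * sourceMean n hb m ‖x‖ - -m * sourceMean n hb m 0) (𝓝 0) (𝓝 0) := by
      have hc : Continuous fun x : EuclideanSpace ℝ (Fin (n + 1)) =>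
          -m * sourceMean n hb m ‖x‖ - -m * sourceMean n hb m 0 := by
        have := continuous_sourceMean n hb m
        fun_prop
      simpa using hc.tendsto 0
    -- The gradient is a continuous scalar times `x`; at the origin the remainder is `o(1)` times
    -- `x`.
    have h := ((Asymptotics.isLittleO_one_iff ℝ).2 ht).smul_isBigO
      (Asymptotics.isBigO_refl (fun x : EuclideanSpace ℝ (Fin (n + 1)) => x) (𝓝 0))
    simp only [one_smul] at h
    refine h.congr_left fun y => ?_
    simp [ballGradient, ballHessian, source_zero_sub]
    module
  · have hx' := norm_ne_zero_iff.2 hx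
    refine (hasFDerivAt_norm_smul hx ((hasDerivAt_sourceMean n hb m hx').const_mul
      (-m))).congr_fderiv ?_
    rw [ballHessian]
    congr 2
    field_simp

/-- `lineProj` need not be continuous at `0`, but it has norm at most `1` and its coefficient tends
to `0`. -/
theorem continuous_ballHessian : Continuous (ballHessian n hb m) := by
  have h1 := continuous_sourceMean n hb m
  have h2 := continuous_source n hb m
  set q : EuclideanSpace ℝ (Fin (n + 1)) → ℝ := fun x =>
    -m * (source n hb m ‖x‖ - (n + 1) * sourceMean n hb m ‖x‖) with hq
  have hqc : Continuous q := by fun_prop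
  refine Continuous.add (by fun_prop) (continuous_iff_continuousAt.2 fun x => ?_)
  rcases eq_or_ne x 0 with rfl | hx
  · have hq0 : q 0 = 0 := by simp only [hq, norm_zero, source_zero_sub, mul_zero]
    have ht : Tendsto (fun x => ‖q x‖) (𝓝 0) (𝓝 0) := by
      simpa [hq0] using hqc.norm.tendsto 0
    change Tendsto (fun x => q x • lineProj x) (𝓝 0) (𝓝 (q 0 • lineProj 0))
    rw [hq0, zero_smul]
    refine squeeze_zero_norm (fun y => ?_) ht
    rw [norm_smul]
    exact mul_le_of_le_one_right (norm_nonneg _) (norm_lineProj_le y)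
  · exact hqc.continuousAt.smul (continuousAt_lineProj hx)

theorem contDiff_ballSolution : ContDiff ℝ 2 (ballSolution n hb m) := by
  have hG : ContDiff ℝ 1 (ballGradient n hb m) := contDiff_one_iff_hasFDerivAt.2
    ⟨_, continuous_ballHessian n hb m, hasFDerivAt_ballGradient n hb m⟩
  rw [show (2 : WithTop ℕ∞) = (1 : ℕ) + 1 by norm_num, contDiff_succ_iff_hasFDerivAt]
  exact ⟨_, (innerSL ℝ).contDiff.comp hG, hasFDerivAt_ballSolution n hb m⟩

theorem laplacian_ballSolution (x : EuclideanSpace ℝ (Fin (n + 1))) :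
    Δ (ballSolution n hb m) x = -m * source n hb m ‖x‖ := by
  rw [laplacian_eq_sum_inner (EuclideanSpace.basisFun (Fin (n + 1)) ℝ)
    (Eventually.of_forall (hasFDerivAt_ballSolution n hb m)) (hasFDerivAt_ballGradient n hb m x),
    ballHessian]
  rcases eq_or_ne x 0 with rfl | hx
  · have h := source_zero_sub n hb m
    simp [h, real_inner_smul_left]
    linear_combination -m * h
  · rw [sum_inner_smul_id_add x hx]
    ring

theorem uniqueDiffOn_closedBall :
    UniqueDiffOn ℝ (Metric.closedBall (0 : EuclideanSpace ℝ (Fin n)) 1) :=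
  uniqueDiffOn_convex (convex_closedBall _ _) (by
    rw [interior_closedBall _ one_ne_zero]
    exact Metric.nonempty_ball.2 one_pos)

theorem isRadialNeumannEigenfunction_ballSolution (h : m * sourceMean n hb m 1 = 0) :
    IsRadialNeumannEigenfunction (n + 1) b m (ballSolution n hb m) where
  contDiffOn := (contDiff_ballSolution n hb m).contDiffOn
  radial := ⟨radialSolution n hb m, fun _ _ => rfl⟩
  equation x hx := by
    rw [mem_ball_zero_iff] at hx
    rw [laplacian_ballSolution, source_eq n hb m ⟨norm_nonneg x, hx.le⟩, ballSolution]
    ring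
  neumann x hx := by
    rw [(hasFDerivAt_ballSolution n hb m x).hasFDerivWithinAt.fderivWithin
      (uniqueDiffOn_closedBall _ x (Metric.sphere_subset_closedBall hx))]
    rw [mem_sphere_zero_iff_norm] at hx
    simp [ballGradient, hx, mul_eq_zero.1 h]
  ne_zero := ⟨0, by simp, by simp [ballSolution, radialSolution_zero]⟩

variable {n m}

/-- Restriction to a ray gives regularity and the conditions at the end points. Off the centre the
gradient of `U` is `(ψ'(|y|)/|y|) y`, whose divergence is the radial form of the Laplacian. -/
theorem isNeumannEigenfunction_of_isRadialProfile
    {U : EuclideanSpace ℝ (Fin (n + 1)) → ℝ} {ψ : ℝ → ℝ}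
    (hU : IsRadialNeumannEigenfunction (n + 1) b m U) (hψ : IsRadialProfile (n + 1) U ψ) :
    IsNeumannEigenfunction (n + 1) b m ψ := by
  set e : EuclideanSpace ℝ (Fin (n + 1)) := EuclideanSpace.single 0 1
  have he : ‖e‖ = 1 := by simp [e]
  set B := Metric.closedBall (0 : EuclideanSpace ℝ (Fin (n + 1))) 1 with hB
  have hray : ∀ v : EuclideanSpace ℝ (Fin (n + 1)), ‖v‖ = 1 →
      MapsTo (fun r : ℝ => r • v) (Icc 0 1) B ∧ EqOn ψ (fun r => U (r • v)) (Icc 0 1) := by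
    intro v hv
    have hm : MapsTo (fun r : ℝ => r • v) (Icc 0 1) B := fun r hr => by
      rw [hB, mem_closedBall_zero_iff, norm_smul, hv, mul_one, Real.norm_of_nonneg hr.1]
      exact hr.2
    refine ⟨hm, fun r hr => ?_⟩
    simp only
    rw [hψ _ (hm hr), norm_smul, hv, mul_one, Real.norm_of_nonneg hr.1]
  have hC : ContDiffOn ℝ 2 ψ (Icc 0 1) :=
    (hU.contDiffOn.comp (by fun_prop : ContDiff ℝ 2 fun r : ℝ => r • e).contDiffOn
      (hray e he).1).congr (hray e he).2
  have hder : ∀ v : EuclideanSpace ℝ (Fin (n + 1)), ‖v‖ = 1 → ∀ r ∈ Icc (0 : ℝ) 1,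
      derivWithin ψ (Icc 0 1) r = fderivWithin ℝ U B (r • v) v := fun v hv r hr => by
    have h1 := ((hU.contDiffOn.differentiableOn (by norm_num)) _
      ((hray v hv).1 hr)).hasFDerivWithinAt
    have h2 : HasDerivWithinAt (fun r : ℝ => r • v) v (Icc 0 1) r := by
      simpa using ((hasDerivAt_id r).smul_const v).hasDerivWithinAt
    exact ((h1.comp_hasDerivWithinAt r h2 (hray v hv).1).congr (hray v hv).2
      ((hray v hv).2 hr)).derivWithin (uniqueDiffOn_Icc zero_lt_one r hr)
  refine ⟨⟨hC, fun r hr => ?_, ?_, ?_⟩, ?_⟩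
  · have hCo : ContDiffOn ℝ 2 ψ (Ioo 0 1) := hC.mono Ioo_subset_Icc_self
    have hCd : ContDiffOn ℝ 1 (deriv ψ) (Ioo 0 1) := hCo.deriv_of_isOpen isOpen_Ioo (by norm_num)
    have hd : ∀ s ∈ Ioo (0 : ℝ) 1, HasDerivAt ψ (deriv ψ s) s := fun s hs =>
      ((hCo.differentiableOn (by norm_num)).differentiableAt (isOpen_Ioo.mem_nhds hs)).hasDerivAt
    have hdd := ((hCd.differentiableOn (by norm_num)).differentiableAt
      (isOpen_Ioo.mem_nhds hr)).hasDerivAt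
    have hr0 := hr.1.ne'
    set x := r • e with hxdef
    have hxr : ‖x‖ = r := by rw [hxdef, norm_smul, he, mul_one, Real.norm_of_nonneg hr.1.le]
    have hx0 : x ≠ 0 := norm_ne_zero_iff.1 (by rw [hxr]; exact hr0)
    have hxB : x ∈ Metric.ball (0 : EuclideanSpace ℝ (Fin (n + 1))) 1 := by
      rw [mem_ball_zero_iff, hxr]
      exact hr.2
    have hgrad : ∀ᶠ y in 𝓝 x, HasFDerivAt U (innerSL ℝ ((deriv ψ ‖y‖ / ‖y‖) • y)) y := by
      filter_upwards [Metric.isOpen_ball.mem_nhds hxB, isOpen_ne.mem_nhds hx0] with y hy hy0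
      have hy1 := mem_ball_zero_iff.1 hy
      refine (hasFDerivAt_comp_norm hy0
        (hd ‖y‖ ⟨norm_pos_iff.2 hy0, hy1⟩)).congr_of_eventuallyEq ?_
      filter_upwards [Metric.isOpen_ball.mem_nhds hy] with z hz
      exact hψ z (Metric.ball_subset_closedBall hz)
    have hG : HasDerivAt (fun s => deriv ψ s / s)
        ((deriv (deriv ψ) r * r - deriv ψ r * 1) / r ^ 2) ‖x‖ := by
      rw [hxr]
      exact hdd.div (hasDerivAt_id r) hr0
    have hlap := laplacian_eq_sum_inner (EuclideanSpace.basisFun (Fin (n + 1)) ℝ) hgrad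
      (hasFDerivAt_norm_smul hx0 hG)
    rw [sum_inner_smul_id_add x hx0] at hlap
    have heq := hU.equation x hxB
    rw [hlap, hψ x (Metric.ball_subset_closedBall hxB), hxr] at heq
    rw [← heq]
    push_cast
    field_simp
    ring
  -- Opposite rays carry the same profile, so `ψ'(0)` equals its own negative.
  · have h1 := hder e he 0 (by simp)
    have h2 := hder (-e) (by rw [norm_neg, he]) 0 (by simp)
    rw [zero_smul] at h1 h2
    rw [map_neg, ← h1] at h2
    linarith
  · rw [hder e he 1 (by simp), one_smul]
    exact hU.neumann e (by rw [mem_sphere_zero_iff_norm, he])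
  · obtain ⟨x, hx, hne⟩ := hU.ne_zero
    rw [hψ x hx] at hne
    exact ⟨‖x‖, ⟨norm_nonneg x, mem_closedBall_zero_iff.1 hx⟩, hne⟩

end

/-! ### Replacing the coefficient by a continuous extension, and conclusion -/

theorem isNeumannEigenfunction_congr {N : ℕ} {a b : ℝ → ℝ} (hab : EqOn a b (Icc 0 1)) :
    IsNeumannEigenfunction N a = IsNeumannEigenfunction N b := by
  have key : ∀ {a b : ℝ → ℝ}, EqOn a b (Icc 0 1) → ∀ m u,
      IsNeumannEigenfunction N a m u → IsNeumannEigenfunction N b m u := fun h m u hu =>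
    ⟨⟨hu.1.contDiffOn, fun r hr => by
      rw [hu.1.equation r hr, h (Ioo_subset_Icc_self hr)], hu.1.neumann_zero, hu.1.neumann_one⟩,
      hu.2⟩
  exact funext₂ fun m u => propext ⟨key hab m u, key hab.symm m u⟩

theorem isRadialNeumannEigenfunction_congr {N : ℕ} {a b : ℝ → ℝ} (hab : EqOn a b (Icc 0 1)) :
    IsRadialNeumannEigenfunction N a = IsRadialNeumannEigenfunction N b := by
  have key : ∀ {a b : ℝ → ℝ}, EqOn a b (Icc 0 1) → ∀ m U,
      IsRadialNeumannEigenfunction N a m U → IsRadialNeumannEigenfunction N b m U :=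
    fun h m U hU => ⟨hU.contDiffOn, hU.radial, fun x hx => by
      rw [hU.equation x hx, h ⟨norm_nonneg x, (mem_ball_zero_iff.1 hx).le⟩], hU.neumann, hU.ne_zero⟩
  exact funext₂ fun m U => propext ⟨key hab m U, key hab.symm m U⟩

end RadialNeumann

open RadialNeumann in
theorem theorem2p2 (N : ℕ) (hN : 2 ≤ N) (a : ℝ → ℝ) (ha : ContinuousOn a (Icc 0 1))
    (hpos : ∀ r ∈ Icc (0 : ℝ) 1, 0 < a r) :
    ∃ μ : ℕ → ℝ, μ 0 = 0 ∧ StrictMono μ ∧ Tendsto μ atTop atTop ∧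
      -- the singular Sturm–Liouville problem on the interval
      ({m : ℝ | IsNeumannEigenvalue N a m} = range μ ∧
        ∀ k : ℕ,
          (∀ u v : ℝ → ℝ, IsNeumannEigenfunction N a (μ k) u →
            IsNeumannEigenfunction N a (μ k) v →
            ∃ c : ℝ, ∀ r ∈ Icc (0 : ℝ) 1, v r = c * u r) ∧
          (∀ ψ : ℝ → ℝ, IsNeumannEigenfunction N a (μ k) ψ →
            HasExactlySimpleZeros ψ k ∧
            (IsMonotoneOnUnitInterval ψ ↔ k = 0 ∨ k = 1))) ∧
      -- the radial problem in the unit ball, with the same sequence of eigenvalues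
      ({m : ℝ | IsRadialNeumannEigenvalue N a m} = range μ ∧
        ∀ k : ℕ,
          (∀ U V : EuclideanSpace ℝ (Fin N) → ℝ, IsRadialNeumannEigenfunction N a (μ k) U →
            IsRadialNeumannEigenfunction N a (μ k) V →
            ∃ c : ℝ, ∀ x ∈ Metric.closedBall (0 : EuclideanSpace ℝ (Fin N)) 1,
              V x = c * U x) ∧
          (∀ (Ψ : EuclideanSpace ℝ (Fin N) → ℝ) (ψ : ℝ → ℝ),
            IsRadialNeumannEigenfunction N a (μ k) Ψ → IsRadialProfile N Ψ ψ →
            HasExactlySimpleZeros ψ k ∧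
            (IsMonotoneOnUnitInterval ψ ↔ k = 0 ∨ k = 1))) := by
  obtain ⟨n, rfl⟩ : ∃ n, N = n + 1 := ⟨N - 1, by omega⟩
  obtain ⟨b, hb, hab⟩ : ∃ b : ℝ → ℝ, Continuous b ∧ EqOn a b (Icc 0 1) :=
    ⟨IccExtend zero_le_one ((Icc 0 1).domRestrict a), ha.domRestrict.Icc_extend',
      fun r hr => (IccExtend_of_mem zero_le_one ((Icc (0 : ℝ) 1).domRestrict a) hr).symm⟩
  have hbpos : ∀ r ∈ Icc (0 : ℝ) 1, 0 < b r := fun r hr => hab hr ▸ hpos r hr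
  simp only [IsNeumannEigenvalue, IsRadialNeumannEigenvalue, isNeumannEigenfunction_congr hab,
    isRadialNeumannEigenfunction_congr hab]
  obtain ⟨L, hL, hL0, hLmono, hLtop⟩ := exists_eigenparameters n hb hbpos
  have hLnn : ∀ k, 0 ≤ L k := fun k => hL0 ▸ hLmono.monotone (Nat.zero_le k)
  -- One scalar equation characterises the eigenvalues of both problems, so the two spectra
  -- coincide.
  have hval : ∀ m, m * sourceMean n hb m 1 = 0 ↔ m ∈ range fun k => L k ^ 2 := fun m => by
    constructor
    · intro h
      obtain ⟨l, k, rfl, hk⟩ := exists_eigenparameter_of_mul_sourceMean_eq_zero n hb hbpos h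
      have hl : L k = l := (strictMono_pruferAngle_one n hb hbpos).injective ((hL k).trans hk.symm)
      exact ⟨k, by rw [← hl]⟩
    · rintro ⟨k, rfl⟩
      exact mul_sourceMean_eq_zero n hb (L k) (hL k)
  have hprop : ∀ k ψ, IsNeumannEigenfunction (n + 1) b (L k ^ 2) ψ →
      HasExactlySimpleZeros ψ k ∧ (IsMonotoneOnUnitInterval ψ ↔ k = 0 ∨ k = 1) := fun k ψ hψ =>
    have h := eqOn_of_isNeumannEigenfunction hb hψ
    zeros_and_monotonicity n hb hbpos (hL k) h.1 h.2.1
  refine ⟨fun k => L k ^ 2, by simp [hL0],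
    fun i j hij => pow_lt_pow_left₀ (hLmono hij) (hLnn i) two_ne_zero,
    (tendsto_pow_atTop two_ne_zero).comp hLtop, ⟨?_, fun k => ⟨fun u v hu hv =>
      exists_eq_mul_of_isNeumannEigenfunction hb hu hv, hprop k⟩⟩, ⟨?_, fun k => ⟨?_, ?_⟩⟩⟩
  · ext m
    rw [← hval]
    exact ⟨fun ⟨u, hu⟩ => (eqOn_of_isNeumannEigenfunction hb hu).2.2,
      fun h => ⟨_, isNeumannEigenfunction_radialSolution hb h⟩⟩
  · ext m
    rw [← hval]
    refine ⟨fun ⟨U, hU⟩ => ?_, fun h => ⟨_, isRadialNeumannEigenfunction_ballSolution n hb m h⟩⟩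
    obtain ⟨f, hf⟩ := hU.radial
    exact (eqOn_of_isNeumannEigenfunction hb (isNeumannEigenfunction_of_isRadialProfile hU hf)).2.2
  · intro U V hU hV
    obtain ⟨f, hf⟩ := hU.radial
    obtain ⟨g, hg⟩ := hV.radial
    obtain ⟨c, hc⟩ := exists_eq_mul_of_isNeumannEigenfunction hb
      (isNeumannEigenfunction_of_isRadialProfile hU hf)
      (isNeumannEigenfunction_of_isRadialProfile hV hg)
    refine ⟨c, fun x hx => ?_⟩
    rw [hf x hx, hg x hx]
    exact hc _ ⟨norm_nonneg x, mem_closedBall_zero_iff.1 hx⟩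
  · exact fun Ψ ψ hΨ hψ => hprop k ψ (isNeumannEigenfunction_of_isRadialProfile hΨ hψ)
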